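/- **Setting.** Fix $\gamma,\ell_P,\Delta>0$. Let $L$ be the finite set of links crossing a closed surface $\mathfrak S$. A sector is a spin profile $\alpha=(j_l)_{l\in L}$, $j_l\in\{0,\tfrac12,1,\dots\}$; its punctures are the links with $j_l\neq0$, and its area is $8\pi\gamma\ell_P^2\sum_l\sqrt{j_l(j_l+1)}$. Let $\mathcal H=\bigoplus_{\alpha\in\Lambda}\mathcal H_{A,\alpha}\otimes\mathcal H_{\bar A,\alpha}$ with $\Lambda$ finite and all $\mathcal H_{A,\alpha},\mathcal H_{\bar A,\alpha}$ finite-dimensional Hilbert spaces. For $\rho=|\Psi\rangle\langle\Psi|$ put $p_\alpha=\mathrm{Tr}\,\rho_{\alpha\alpha}$, $\rho_{A,\alpha}=p_\alpha^{-1}\mathrm{Tr}_{\bar A,\alpha}\rho_{\alpha\alpha}$. For weights $\lambda_\alpha>0$ put $\hat\rho=\bigoplus_\alpha p_\alpha\lambda_\alpha^{-1}\rho_{A,\alpha}\otimes I$, $\hat{\mathrm{Tr}}=\sum_\alpha\frac{\lambda_\alpha}{\dim\mathcal H_{\bar A,\alpha}}\mathrm{Tr}_\alpha$, and define the entanglement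 entropy $S=-\hat{\mathrm{Tr}}(\hat\rho\log\hat\rho)$; $\lambda_\alpha=1$ unless stated otherwise. For $\mathrm{Ar}\in\mathbb R$ let $\mathcal W(\mathrm{Ar})$ be the set of all $(N;j_1,\dots,j_N)$ with $N\ge1$ and nonzero spins $j_i$ such that $\mathrm{Ar}-\Delta\le 8\pi\gamma\ell_P^2\sum_i\sqrt{j_i(j_i+1)}\le\mathrm{Ar}+\Delta$. Put $\mathcal D_G=\sum_{\mathcal W(\mathrm{Ar})}\prod_iG(j_i)$ and $\mathcal D=\mathcal D_1=\#\mathcal W(\mathrm{Ar})$. A *fixed-area state* is a unit vector $\Psi\in\mathcal H$ whose nonzero components all lie in sectors with area in $[\mathrm{Ar}-\Delta,\mathrm{Ar}+\Delta]$, and such that the puncture sets of any two of these sectors are equal or have different cardinalities. It has *no bulk entanglement* if each component is a pure tensor. Say that $\mathcal H$ *admits all profiles* if for each $N$ occurring in $\mathcal W(\mathrm{Ar})$ there is a set $P_N\subset L$ with $|P_N|=N$ such that each $\alpha$ with puncture set $P_N$ and area in the window is in $\Lambda$ and has $\mathcal H_{A,\alpha},\mathcal H_{\bar A,\alpha}\ne0$.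 **Theorem.** The sets $\mathcal W(\mathrm{Ar})$ are finite, and the following hold. 1. Let $\mathrm{Ar}>\Delta$. Every fixed-area state with no bulk entanglement satisfies $S\le\log\mathcal D$, with equality iff $p_\alpha\in\{0,1/\mathcal D\}$ for all $\alpha$. If $\mathcal W(\mathrm{Ar})\neq\emptyset$ and $\mathcal H$ admits all profiles, some such state has $S=\log\mathcal D$. 2. Let $G\ge0$ be such that $G(j),G(j')>0$ for some nonzero $j,j'$ with $\sqrt{j(j+1)}/\sqrt{j'(j'+1)}$ irrational (e.g. $G>0$). Let $\beta$ satisfy $\sum_{j\ne0}G(j)e^{-\beta\sqrt{j(j+1)}}=1$ and $\sum_{j\neq0}\sqrt{j(j+1)}\,G(j)e^{-\beta\sqrt{j(j+1)}}<\infty$. Then $\beta$ is the only solution of the first equation, $\mathcal D_G>0$ for all large $\mathrm{Ar}$, and $$\log\mathcal D_G=\frac{\beta}{8\pi\gamma\ell_P^2}\mathrm{Ar}+O(1)\qquad(\mathrm{Ar}\to\infty).$$ 3. For $G=1$ there is a unique solution $\beta_0$; $|\beta_0-1.01527|<5\cdot10^{-6}$, $\mathcal D>0$ for all large $\mathrm{Ar}$,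 and $\log\mathcal D=\frac{\beta_0}{8\pi\gamma\ell_P^2}\mathrm{Ar}+O(1)$. 4. (Puncture-factorised bulk entanglement.) Let $\mathrm{Ar}>\Delta$, let $G\ge0$, and let $\psi_\alpha\in\mathcal H_{A,\alpha}\otimes\mathcal H_{\bar A,\alpha}$ be such that for each $\alpha\in\Lambda$ in the area window $\psi_\alpha$ is a unit vector whose reduced density operator has von Neumann entropy $S_\alpha$ with $e^{S_\alpha}=\prod_{l:\,j_l\ne0}G(j_l)$. Every fixed-area state of the form $\sum_\alpha p_\alpha^{1/2}\psi_\alpha$ satisfies $S\le\log\mathcal D_G$, with equality iff $p_\alpha\in\{0,e^{S_\alpha}/\mathcal D_G\}$ for all $\alpha$; if $\mathcal W(\mathrm{Ar})\ne\emptyset$ and $\mathcal H$ admits all profiles, some such state has $S=\log\mathcal D_G$. Moreover, if $\psi_\alpha=\bigotimes_{l:\,j_l\neq0}F(j_l)$ with bipartite unit vectors $F(j)$ (regarded as matrices), then $\psi_\alpha$ is a unit vector and $e^{S_\alpha}=\prod_{l:\,j_l\ne0}G(j_l)$ with $G(j)=\exp\left(-\mathrm{Tr}\,F(j)F(j)^\dagger\log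 F(j)F(j)^\dagger\right)$. 5. (Edge modes.) Take $\lambda_\alpha=\prod_{l:\,j_l\ne0}(2j_l+1)$ and $G(j)=2j+1$. For $\mathrm{Ar}>\Delta$, every fixed-area state with no bulk entanglement satisfies $S\le\log\mathcal D_G$, with equality iff $p_\alpha\in\{0,\lambda_\alpha/\mathcal D_G\}$ for all $\alpha$; if $\mathcal W(\mathrm{Ar})\ne\emptyset$ and $\mathcal H$ admits all profiles, some such state has $S=\log\mathcal D_G$. The equation for $\beta$ has a unique solution, it satisfies $|\beta/2\pi-0.274067|<5\cdot10^{-7}$, $\mathcal D_G>0$ for all large $\mathrm{Ar}$, and $\log\mathcal D_G=\frac{\beta}{8\pi\gamma\ell_P^2}\mathrm{Ar}+O(1)$. -/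

import Mathlib

namespace LQG

open scoped Kronecker ComplexConjugate

/-! ## Finite-dimensional Hilbert spaces of the form `⊕_s H_{A,s} ⊗ H_{B,s}`

`B` stands for the complement of the region `A`.  The sectors `s` range over a finite type `S`; each
`H_{A,s}` and `H_{B,s}` is described in an orthonormal basis indexed by `a s` and `b s`. -/

section Algebraic

variable {S : Type*} [Fintype S] [DecidableEq S]
  {a b : S → Type*} [∀ s, Fintype (a s)] [∀ s, DecidableEq (a s)]
  [∀ s, Fintype (b s)] [∀ s, DecidableEq (b s)]

/-- The index set of the product orthonormal basis of `⊕_s H_{A,s} ⊗ H_{B,s}`. -/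
abbrev SumIndex {S : Type*} (a b : S → Type*) : Type _ := (s : S) × (a s × b s)

/-- The Hilbert space `⊕_s H_{A,s} ⊗ H_{B,s}`. -/
abbrev SumSpace {S : Type*} (a b : S → Type*) : Type _ := EuclideanSpace ℂ (SumIndex a b)

/-- The coefficient matrix of the component of `Ψ` in the sector `s`. -/
def component (Ψ : SumSpace a b) (s : S) : Matrix (a s) (b s) ℂ :=
  Matrix.of fun i k => Ψ ⟨s, (i, k)⟩

/-- The density operator `|Ψ⟩⟨Ψ|`. -/
def pureDensity (Ψ : SumSpace a b) : Matrix (SumIndex a b) (SumIndex a b) ℂ :=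
  Matrix.of fun x y => Ψ x * conj (Ψ y)

/-- The diagonal block of an operator in the sector `s`. -/
def block (O : Matrix (SumIndex a b) (SumIndex a b) ℂ) (s : S) :
    Matrix (a s × b s) (a s × b s) ℂ :=
  O.submatrix (fun x => ⟨s, x⟩) (fun x => ⟨s, x⟩)

/-- Partial trace over the second tensor factor. -/
def partialTrace {m n : Type*} [Fintype n] (X : Matrix (m × n) (m × n) ℂ) : Matrix m m ℂ :=
  Matrix.of fun i i' => ∑ k, X (i, k) (i', k)

/-- The probability `p_s` of the sector `s`. -/
noncomputable def sectorProb (ρ : Matrix (SumIndex a b) (SumIndex a b) ℂ) (s : S) : ℝ :=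
  (partialTrace (block ρ s)).trace.re

/-- The normalised reduced density operator `ρ_{A,s} = p_s⁻¹ Tr_B ρ_{ss}`. -/
noncomputable def reducedDensity (ρ : Matrix (SumIndex a b) (SumIndex a b) ℂ) (s : S) :
    Matrix (a s) (a s) ℂ :=
  ((sectorProb ρ s)⁻¹ : ℝ) • partialTrace (block ρ s)

/-- The renormalised density operator `⊕_s (p_s / λ_s) ρ_{A,s} ⊗ 1`, an element of the algebra
`⊕_s (L(H_{A,s}) ⊗ 1)`. -/
noncomputable def renDensity (lam : S → ℝ) (ρ : Matrix (SumIndex a b) (SumIndex a b) ℂ) :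
    Matrix (SumIndex a b) (SumIndex a b) ℂ :=
  Matrix.blockDiagonal' fun s =>
    (sectorProb ρ s * (lam s)⁻¹) • (reducedDensity ρ s ⊗ₖ (1 : Matrix (b s) (b s) ℂ))

/-- The renormalised trace `∑_s (λ_s / dim H_{B,s}) Tr_s`; on `⊕_s (O_s ⊗ 1)` it is
`∑_s λ_s Tr O_s`. -/
noncomputable def renTrace (lam : S → ℝ) (O : Matrix (SumIndex a b) (SumIndex a b) ℂ) : ℂ :=
  ∑ s, ((lam s / Fintype.card (b s) : ℝ) : ℂ) * (block O s).trace

/-- The entanglement entropy `-Tr^ (ρ^ log ρ^)` with respect to the algebra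
`⊕_s (L(H_{A,s}) ⊗ 1)`, for the normalisation `λ` of the trace. -/
noncomputable def entropy (lam : S → ℝ) (ρ : Matrix (SumIndex a b) (SumIndex a b) ℂ) : ℝ :=
  -(renTrace lam (renDensity lam ρ * cfc Real.log (renDensity lam ρ))).re

end Algebraic

/-- The von Neumann entropy `-Tr (ρ log ρ)` of a density matrix. -/
noncomputable def vonNeumann {n : Type*} [Fintype n] [DecidableEq n] (ρ : Matrix n n ℂ) : ℝ :=
  -(ρ * cfc Real.log ρ).trace.re

/-! ## Area spectrum and spin profiles

Spins are labelled by `k = 2j`. -/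

/-- The spin `j = k / 2`. -/
noncomputable def spin (k : ℕ) : ℝ := (k : ℝ) / 2

/-- `√(j (j + 1))` for `j = k / 2`. -/
noncomputable def spinArea (k : ℕ) : ℝ := √(spin k * (spin k + 1))

/-- A profile `(N, 𝒥)`: a number `N ≥ 1` of punctures with nonzero spins `j_1, …, j_N`. -/
abbrev SpinProfile : Type := (N : ℕ+) × (Fin N → ℕ+)

/-- The area of a profile. -/
noncomputable def profileArea (γ ℓ : ℝ) (J : SpinProfile) : ℝ :=
  8 * Real.pi * γ * ℓ ^ 2 * ∑ i, spinArea (J.2 i)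

/-- The profiles whose area lies in `[Ar - Δ, Ar + Δ]`. -/
def window (γ ℓ Ar Δ : ℝ) : Set SpinProfile :=
  {J | profileArea γ ℓ J ∈ Set.Icc (Ar - Δ) (Ar + Δ)}

/-- The number of profiles in the window. -/
noncomputable def microCount (γ ℓ Δ Ar : ℝ) : ℝ := ((window γ ℓ Ar Δ).ncard : ℝ)

/-- The number of profiles in the window, a spin `j = k / 2` carrying the degeneracy `G k`. -/
noncomputable def weightedCount (G : ℕ → ℝ) (γ ℓ Δ Ar : ℝ) : ℝ :=
  ∑ᶠ J ∈ window γ ℓ Ar Δ, ∏ i, G (J.2 i)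

/-- `∑_{j ≠ 0} G(j) exp (-β √(j (j + 1))) = 1`. -/
def SolvesBeta (G : ℕ → ℝ) (β : ℝ) : Prop :=
  HasSum (fun k : ℕ+ => G k * Real.exp (-β * spinArea k)) 1

/-- `log D(Ar) = β / (8 π γ ℓ²) Ar + O(1)` as `Ar → ∞` (and `D(Ar) > 0` for all large `Ar`). -/
def AreaLaw (γ ℓ β : ℝ) (D : ℝ → ℝ) : Prop :=
  (∀ᶠ Ar in Filter.atTop, 0 < D Ar) ∧
    (fun Ar => Real.log (D Ar) - β / (8 * Real.pi * γ * ℓ ^ 2) * Ar) =O[Filter.atTop]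
      (fun _ => (1 : ℝ))

/-! ## Fixed-area states

`L` is the finite set of links crossing the surface.  A superselection sector is a spin profile
`α : L → ℕ` (twice the spins, `0` allowed); the truncated Hilbert space keeps a finite set `Λ` of
sectors. -/

section States

variable {L : Type*} [Fintype L] [DecidableEq L]

/-- The punctures carrying a nontrivial spin. -/
def punctures (α : L → ℕ) : Finset L := Finset.univ.filter fun l => α l ≠ 0

/-- The eigenvalue of the area operator in the sector `α`. -/
noncomputable def sectorArea (γ ℓ : ℝ) (α : L → ℕ) : ℝ :=
  8 * Real.pi * γ * ℓ ^ 2 * ∑ l ∈ punctures α, spinArea (α l)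

/-- The area of the sector `α` lies in `[Ar - Δ, Ar + Δ]`. -/
def InShell (γ ℓ Ar Δ : ℝ) (α : L → ℕ) : Prop :=
  sectorArea γ ℓ α ∈ Set.Icc (Ar - Δ) (Ar + Δ)

/-- The dimension `∏_l (2 j_l + 1)` of the representation of the gauge group at the punctures. -/
noncomputable def edgeWeight (α : L → ℕ) : ℝ := ∏ l ∈ punctures α, (2 * spin (α l) + 1)

variable (Λ : Finset (L → ℕ)) (a b : (L → ℕ) → Type*)
  [∀ α, Fintype (a α)] [∀ α, DecidableEq (a α)] [∀ α, Fintype (b α)] [∀ α, DecidableEq (b α)]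

/-- The truncated Hilbert space `⊕_{α ∈ Λ} H_{A,α} ⊗ H_{B,α}`. -/
abbrev StateSpace : Type _ := SumSpace (fun α : Λ => a α) (fun α : Λ => b α)

variable {Λ a b}

/-- Normalised states all of whose sectors lie in the area shell, and in which different sets of
punctures have different cardinalities. -/
structure IsFixedArea (γ ℓ Ar Δ : ℝ) (Ψ : StateSpace Λ a b) : Prop where
  norm_eq : ‖Ψ‖ = 1
  puncture_sets : ∀ α α' : Λ, component Ψ α ≠ 0 → component Ψ α' ≠ 0 →
    (punctures α.1).card = (punctures α'.1).card → punctures α.1 = punctures α'.1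
  in_shell : ∀ α : Λ, component Ψ α ≠ 0 → InShell γ ℓ Ar Δ α.1

/-- In every sector the state is a pure tensor. -/
def NoBulkEntanglement (Ψ : StateSpace Λ a b) : Prop :=
  ∀ α : Λ, ∃ (u : a α → ℂ) (v : b α → ℂ), component Ψ α = Matrix.vecMulVec u v

/-- `Ψ = ∑_α p_α^{1/2} ψ_α` for the given bulk states `ψ_α`, whose coefficient matrices are `ψ α`. -/
def HasBulkStates (ψ : ∀ α, Matrix (a α) (b α) ℂ) (Ψ : StateSpace Λ a b) : Prop :=
  ∃ p : Λ → ℝ, (∀ α, 0 ≤ p α) ∧ ∀ α : Λ, component Ψ α = (√(p α) : ℝ) • ψ α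

/-- The sector probabilities of a state vector. -/
noncomputable def prob (Ψ : StateSpace Λ a b) (α : Λ) : ℝ := sectorProb (pureDensity Ψ) α

/-- The entanglement entropy of a state vector, with `λ_α = 1`. -/
noncomputable def stateEntropy (Ψ : StateSpace Λ a b) : ℝ :=
  entropy (fun _ => 1) (pureDensity Ψ)

/-- The entanglement entropy of a state vector with edge modes, `λ_α = ∏_l (2 j_l + 1)`. -/
noncomputable def edgeEntropy (Ψ : StateSpace Λ a b) : ℝ :=
  entropy (fun α : Λ => edgeWeight α.1) (pureDensity Ψ)

variable (Λ a b)

/-- `P N` is a set of `N` punctures for every `N` that occurs in the area window, and every spin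
profile on it in the area shell is a nonzero sector of the truncated Hilbert space. -/
def Admits (γ ℓ Ar Δ : ℝ) (P : ℕ → Finset L) : Prop :=
  ∀ J ∈ window γ ℓ Ar Δ, (P J.1).card = J.1 ∧
    ∀ α : L → ℕ, punctures α = P J.1 → InShell γ ℓ Ar Δ α →
      α ∈ Λ ∧ Nonempty (a α) ∧ Nonempty (b α)

end States

/-! ## Puncture-factorised bulk states -/

section Factorised

variable {L : Type*} [Fintype L] [DecidableEq L]

/-- Basis labels of `⊗_{l puncture} K_{j_l}`, where `K_j` has a basis indexed by `κ (2 j)`. -/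
abbrev PunctureIndex (κ : ℕ → Type*) (α : L → ℕ) : Type _ := (l : punctures α) → κ (α l)

/-- The coefficient matrix of the product state `⊗_l F(j_l)` over the punctures. -/
def productState {κ κ' : ℕ → Type*} (F : ∀ k, Matrix (κ k) (κ' k) ℂ) (α : L → ℕ) :
    Matrix (PunctureIndex κ α) (PunctureIndex κ' α) ℂ :=
  Matrix.of fun x y => ∏ l : punctures α, F (α l) (x l) (y l)

end Factorised

end LQG

/-! The theorem combines a variational principle for the entropy with a renewal estimate for the
number of profiles.

Entropy. Diagonalising the blocks gives `S = ∑ p_α (S_α + log λ_α - log p_α)`, where `S_α` is the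
bulk entropy of the sector (`entropy_eq_sum`). In each case treated, `λ_α exp S_α = ∏ G(j_l)` on the
sectors present. Gibbs' inequality then bounds `S` by the logarithm of the sum of these weights.
Reading off the spins along an enumeration of the punctures maps the sectors present to profiles in
the window. This map is injective because sectors with equally many punctures share their punctures,
so the sum is at most `𝒟_G`. If all profiles are admitted, the map is a bijection on suitable
sectors, and `p_α = ∏ G(j_l) / 𝒟_G` saturates the bound.

Area law. The weights `q_j = G(j) exp (-β √(j (j + 1)))` form a probability distribution. Tilting by
it makes `𝒟_G exp (-β Ar / (8 π γ ℓ²))`, up to a bounded factor, the expected number of renewals in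
a window of fixed width, which has to be bounded above and below. The upper bound comes from the
renewal identity `sum_weight_mul_tail`. For the lower bound, finite mean shows that intervals of
some fixed length carry mass at least `1/2` (`exists_half_le_mass`). Finitely many prefixes, whose
areas are `δ`-dense in a bounded range by irrationality of a ratio of steps, then move this mass
into the window (`exists_le_closedMass`).

Numerics. The equation for `β` has a decreasing left side, so two values bracket the root. They are
certified in rational arithmetic, using convergents for the square roots, Taylor polynomials for the
exponentials and a geometric series for the tail. -/

namespace LQG

open scoped Kronecker

/-! ## Renewal sums over words -/

section Renewal

variable {ι : Type*}

/-- The total length of a word. -/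
noncomputable def wordArea (s : ι → ℝ) (w : List ι) : ℝ := (w.map s).sum

/-- The product of the weights of the letters of a word. -/
noncomputable def wordWeight (q : ι → ℝ) (w : List ι) : ℝ := (w.map q).prod

@[simp] theorem wordArea_nil (s : ι → ℝ) : wordArea s [] = 0 := by simp [wordArea]

@[simp] theorem wordArea_cons (s : ι → ℝ) (i : ι) (w : List ι) :
    wordArea s (i :: w) = s i + wordArea s w := by simp [wordArea]

@[simp] theorem wordArea_append (s : ι → ℝ) (v w : List ι) :
    wordArea s (v ++ w) = wordArea s v + wordArea s w := by simp [wordArea]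

@[simp] theorem wordWeight_nil (q : ι → ℝ) : wordWeight q [] = 1 := by simp [wordWeight]

@[simp] theorem wordWeight_cons (q : ι → ℝ) (i : ι) (w : List ι) :
    wordWeight q (i :: w) = q i * wordWeight q w := by simp [wordWeight]

@[simp] theorem wordWeight_append (q : ι → ℝ) (v w : List ι) :
    wordWeight q (v ++ w) = wordWeight q v * wordWeight q w := by simp [wordWeight]

theorem wordWeight_nonneg {q : ι → ℝ} (hq : ∀ i, 0 ≤ q i) (w : List ι) : 0 ≤ wordWeight q w := by
  induction w with
  | nil => simp
  | cons i w ih => simpa using mul_nonneg (hq i) ih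

theorem wordArea_nonneg {s : ι → ℝ} (hs : ∀ i, 0 ≤ s i) (w : List ι) : 0 ≤ wordArea s w := by
  induction w with
  | nil => simp
  | cons i w ih => simpa using add_nonneg (hs i) ih

/-- Every letter costs at least `c`, so bounded area bounds the number of letters, and each letter
is drawn from a finite set. The induction removes the first letter. -/
theorem finite_wordArea_le {s : ι → ℝ} {c : ℝ} (hc : 0 < c) (hs : ∀ i, c ≤ s i)
    (hfin : ∀ x, {i | s i ≤ x}.Finite) (x : ℝ) : {w | wordArea s w ≤ x}.Finite := by
  have key : ∀ n : ℕ, ∀ x : ℝ, x < n * c → {w | wordArea s w ≤ x}.Finite := by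
    intro n
    induction n with
    | zero =>
      intro x hx
      convert Set.finite_empty
      ext w
      have := wordArea_nonneg (fun i => hc.le.trans (hs i)) w
      simp only [Nat.cast_zero, zero_mul] at hx
      simp only [Set.mem_ofPred_eq, Set.mem_empty_iff_false, iff_false, not_le]
      linarith
    | succ n ih =>
      intro x hx
      have h2 : ({[]} ∪ ⋃ i ∈ {i | s i ≤ x},
          (List.cons i) '' {w | wordArea s w ≤ x - s i}).Finite := by
        refine (Set.finite_singleton _).union ((hfin x).biUnion fun i _ => ?_)
        refine (ih _ ?_).image _
        have := hs i
        push_cast at hx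
        linarith
      refine h2.subset ?_
      rintro (_ | ⟨i, w⟩) hw
      · simp
      · right
        simp only [Set.mem_ofPred_eq, wordArea_cons] at hw
        have := wordArea_nonneg (fun i => hc.le.trans (hs i)) w
        simp only [Set.mem_iUnion]
        refine ⟨i, ?_, w, ?_, rfl⟩
        · simp only [Set.mem_ofPred_eq]; linarith
        · simp only [Set.mem_ofPred_eq]; linarith
  obtain ⟨n, hn⟩ := exists_nat_gt (x / c)
  exact key n x (by rwa [div_lt_iff₀ hc] at hn)

/-- A renewal process: steps `s i ≥ c > 0` of finite mean taken with probabilities `q i`. -/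
structure IsRenewal (s q : ι → ℝ) (c : ℝ) : Prop where
  pos : 0 < c
  le_step : ∀ i, c ≤ s i
  finite_step : ∀ x, {i | s i ≤ x}.Finite
  nonneg : ∀ i, 0 ≤ q i
  hasSum : HasSum q 1
  mean : Summable fun i => s i * q i

namespace IsRenewal

variable {s q : ι → ℝ} {c : ℝ}

/-- The words of area at most `x`. -/
noncomputable def words (h : IsRenewal s q c) (x : ℝ) : Finset (List ι) :=
  (finite_wordArea_le h.pos h.le_step h.finite_step x).toFinset

/-- The steps of length at most `x`. -/
noncomputable def steps (h : IsRenewal s q c) (x : ℝ) : Finset ι := (h.finite_step x).toFinset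

@[simp] theorem mem_words (h : IsRenewal s q c) {x : ℝ} {w : List ι} :
    w ∈ h.words x ↔ wordArea s w ≤ x := by simp [words]

@[simp] theorem mem_steps (h : IsRenewal s q c) {x : ℝ} {i : ι} :
    i ∈ h.steps x ↔ s i ≤ x := by simp [steps]

theorem step_pos (h : IsRenewal s q c) (i : ι) : 0 < s i := h.pos.trans_le (h.le_step i)

theorem area_nonneg (h : IsRenewal s q c) (w : List ι) : 0 ≤ wordArea s w :=
  wordArea_nonneg (fun i => (h.step_pos i).le) w

theorem weight_nonneg (h : IsRenewal s q c) (w : List ι) : 0 ≤ wordWeight q w :=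
  wordWeight_nonneg h.nonneg w

/-- The probability of a step longer than `t`. -/
noncomputable def tail (h : IsRenewal s q c) (t : ℝ) : ℝ := 1 - ∑ i ∈ h.steps t, q i

theorem tail_nonneg (h : IsRenewal s q c) (t : ℝ) : 0 ≤ h.tail t :=
  sub_nonneg.2 (sum_le_hasSum _ (fun i _ => h.nonneg i) h.hasSum)

theorem tail_le_one (h : IsRenewal s q c) (t : ℝ) : h.tail t ≤ 1 :=
  sub_le_self _ (Finset.sum_nonneg fun i _ => h.nonneg i)

theorem tail_eq_one (h : IsRenewal s q c) {t : ℝ} (ht : t < c) : h.tail t = 1 := by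
  have : h.steps t = ∅ := by
    ext i
    simpa using ht.trans_le (h.le_step i)
  simp [tail, this]

/-- As a sum of indicators over all steps, the tail allows sums over words and over steps to be
exchanged. -/
theorem hasSum_tail (h : IsRenewal s q c) (t : ℝ) :
    HasSum (fun i => if t < s i then q i else 0) (h.tail t) := by
  classical
  have h1 : HasSum (fun i => if i ∈ h.steps t then q i else 0) (∑ i ∈ h.steps t, q i) := by
    have h2 : HasSum (fun i => if i ∈ h.steps t then q i else 0)
        (∑ i ∈ h.steps t, if i ∈ h.steps t then q i else 0) :=
      hasSum_sum_of_ne_finset_zero fun i hi => by simp [hi]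
    rwa [Finset.sum_congr rfl fun i hi => if_pos hi] at h2
  refine (h.hasSum.sub h1).congr_fun fun i => ?_
  by_cases hi : t < s i
  · simp [hi, not_le.2 hi]
  · simp [hi, not_lt.1 hi]

/-- The renewal identity, by decomposing at the last renewal before `x`. -/
theorem sum_weight_mul_tail (h : IsRenewal s q c) {x : ℝ} (hx : 0 ≤ x) :
    ∑ w ∈ h.words x, wordWeight q w * h.tail (x - wordArea s w) = 1 := by
  classical
  -- The lone `1` is the empty word; any other word is uniquely `i :: w` with `s i ≤ x - wordArea s
  -- w`.
  have h1 : ∑ w ∈ h.words x, wordWeight q w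
      = 1 + ∑ w ∈ h.words x, wordWeight q w * ∑ i ∈ h.steps (x - wordArea s w), q i := by
    have hnil : [] ∈ h.words x := by simpa using hx
    rw [← Finset.add_sum_erase _ _ hnil, wordWeight_nil]
    congr 1
    simp_rw [Finset.mul_sum]
    rw [Finset.sum_sigma']
    symm
    refine Finset.sum_bij (fun p _ => p.2 :: p.1) ?_ ?_ ?_ ?_
    · rintro ⟨w, i⟩ hp
      simp only [Finset.mem_sigma, mem_words, mem_steps] at hp
      simp only [Finset.mem_erase, mem_words, wordArea_cons]
      exact ⟨List.cons_ne_nil _ _, by linarith [hp.2]⟩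
    · rintro ⟨w, i⟩ _ ⟨w', i'⟩ _ heq
      simp only [List.cons.injEq] at heq
      rw [heq.1, heq.2]
    · rintro (_ | ⟨i, w⟩) hw
      · simp at hw
      · simp only [Finset.mem_erase, mem_words, wordArea_cons] at hw
        refine ⟨⟨w, i⟩, ?_, rfl⟩
        have := h.step_pos i
        simp only [Finset.mem_sigma, mem_words, mem_steps]
        constructor <;> linarith [hw.2]
    · rintro ⟨w, i⟩ _
      simp [mul_comm]
  simp only [tail, mul_sub, mul_one, Finset.sum_sub_distrib]
  linarith

/-- The expected number of renewals in `(x, y]`. -/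
noncomputable def mass (h : IsRenewal s q c) (x y : ℝ) : ℝ :=
  ∑ w ∈ h.words y with x < wordArea s w, wordWeight q w

/-- From a word with area in `(x - c, x]` every further step overshoots `x`. Its tail is therefore
one, and the renewal identity bounds the total weight of such words. -/
theorem mass_short_le_one (h : IsRenewal s q c) (x : ℝ) : h.mass (x - c) x ≤ 1 := by
  rcases lt_or_ge x 0 with hx | hx
  · have : h.words x = ∅ := by
      ext w
      have := h.area_nonneg w
      simp only [mem_words, Finset.notMem_empty, iff_false, not_le]
      linarith
    simp [mass, this]
  · rw [← h.sum_weight_mul_tail hx, mass]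
    calc ∑ w ∈ h.words x with x - c < wordArea s w, wordWeight q w
        = ∑ w ∈ h.words x with x - c < wordArea s w,
            wordWeight q w * h.tail (x - wordArea s w) := by
          refine Finset.sum_congr rfl fun w hw => ?_
          rw [h.tail_eq_one, mul_one]
          linarith [(Finset.mem_filter.1 hw).2]
      _ ≤ _ := Finset.sum_le_sum_of_subset_of_nonneg (Finset.filter_subset _ _)
          fun w _ _ => mul_nonneg (h.weight_nonneg w) (h.tail_nonneg _)

theorem mass_mono (h : IsRenewal s q c) {x x' y : ℝ} (hx : x ≤ x') : h.mass x' y ≤ h.mass x y := by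
  refine Finset.sum_le_sum_of_subset_of_nonneg ?_ fun w _ _ => h.weight_nonneg w
  intro w hw
  simp only [Finset.mem_filter] at hw ⊢
  exact ⟨hw.1, hx.trans_lt hw.2⟩

theorem mass_le_add (h : IsRenewal s q c) (x y z : ℝ) : h.mass x z ≤ h.mass x y + h.mass y z := by
  classical
  rw [mass, mass, mass]
  refine (Finset.sum_le_sum_of_subset_of_nonneg (t := ((h.words y).filter (x < wordArea s ·)) ∪
    ((h.words z).filter (y < wordArea s ·))) ?_ fun w _ _ => h.weight_nonneg w).trans ?_
  · intro w hw
    simp only [Finset.mem_filter, Finset.mem_union, mem_words] at hw ⊢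
    rcases le_or_gt (wordArea s w) y with h1 | h1
    · exact Or.inl ⟨h1, hw.2⟩
    · exact Or.inr ⟨hw.1, h1⟩
  · rw [← Finset.sum_union_inter]
    exact le_add_of_nonneg_right (Finset.sum_nonneg fun w _ => h.weight_nonneg w)

theorem mass_le_nat (h : IsRenewal s q c) (x : ℝ) (n : ℕ) : h.mass (x - n * c) x ≤ n := by
  induction n with
  | zero =>
    have : (h.words x).filter (x - ((0 : ℕ) : ℝ) * c < wordArea s ·) = ∅ := by
      ext w; simp
    simp only [mass, this]; simp
  | succ n ih =>
    refine (h.mass_le_add _ (x - n * c) _).trans ?_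
    have := h.mass_short_le_one (x - n * c)
    have e : x - ((n + 1 : ℕ) : ℝ) * c = x - n * c - c := by push_cast; ring
    rw [e]; push_cast; linarith

theorem mass_le (h : IsRenewal s q c) (x : ℝ) {t : ℝ} (ht : 0 ≤ t) :
    h.mass (x - t) x ≤ t / c + 1 := by
  have h1 : t / c ≤ ⌈t / c⌉₊ := Nat.le_ceil _
  have h2 := Nat.ceil_lt_add_one (div_nonneg ht h.pos.le)
  rw [div_le_iff₀ h.pos] at h1
  calc h.mass (x - t) x ≤ h.mass (x - ⌈t / c⌉₊ * c) x := h.mass_mono (by linarith)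
    _ ≤ ⌈t / c⌉₊ := h.mass_le_nat _ _
    _ ≤ _ := h2.le

/-- Since the mean step is finite, long enough intervals carry a definite mass. -/
theorem exists_half_le_mass (h : IsRenewal s q c) :
    ∃ M, 0 ≤ M ∧ ∀ x, 0 ≤ x → 1 / 2 ≤ h.mass (x - M) x := by
  classical
  -- `g i` bounds the contribution of step `i` to jumps from below `x - M` to beyond `x`. It is
  -- summable because the mean is finite.
  set g : ι → ℝ := fun i => q i * (s i / c + 1) with hg
  have hg0 : ∀ i, 0 ≤ g i := fun i =>
    mul_nonneg (h.nonneg i) (add_nonneg (div_nonneg (h.step_pos i).le h.pos.le) zero_le_one)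
  have hgs : Summable g := by
    have := (h.mean.mul_right c⁻¹).add h.hasSum.summable
    refine this.congr fun i => ?_
    simp only [hg]; ring
  obtain ⟨F, hF⟩ := summable_iff_vanishing_norm.1 hgs (1 / 2) (by norm_num)
  obtain ⟨M, hM0, hM⟩ : ∃ M, 0 ≤ M ∧ ∀ i ∈ F, s i ≤ M := by
    refine ⟨∑ i ∈ F, s i, Finset.sum_nonneg fun i _ => (h.step_pos i).le, fun i hi => ?_⟩
    exact Finset.single_le_sum (f := s) (fun j _ => (h.step_pos j).le) hi
  refine ⟨M, hM0, fun x hx => ?_⟩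
  have htail : ∑' i, (if M < s i then g i else 0) ≤ 1 / 2 := by
    refine Real.tsum_le_of_sum_le (fun i => by split_ifs <;> simp [hg0]) fun u => ?_
    rw [← Finset.sum_filter]
    have hd : Disjoint (u.filter (M < s ·)) F := by
      rw [Finset.disjoint_left]
      intro i hi hiF
      exact absurd (hM i hiF) (not_le.2 (Finset.mem_filter.1 hi).2)
    have := hF _ hd
    rw [Real.norm_eq_abs] at this
    exact ((le_abs_self _).trans_lt this).le
  -- The renewal identity is split at `x - M`: near words have tail at most one, the others are
  -- kept.
  have hsplit : (1 : ℝ) ≤ h.mass (x - M) x +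
      ∑ w ∈ h.words (x - M), wordWeight q w * h.tail (x - wordArea s w) := by
    rw [← h.sum_weight_mul_tail hx, mass,
      ← Finset.sum_filter_add_sum_filter_not _ (x - M < wordArea s ·)]
    refine add_le_add (Finset.sum_le_sum fun w _ =>
      mul_le_of_le_one_right (h.weight_nonneg w) (h.tail_le_one _)) ?_
    refine Finset.sum_le_sum_of_subset_of_nonneg ?_
      fun w _ _ => mul_nonneg (h.weight_nonneg w) (h.tail_nonneg _)
    intro w hw
    simpa using (Finset.mem_filter.1 hw).2
  -- After exchanging sums, a step `i` overshoots `x` only from a word with area in `(x - s i, x -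
  -- M]`, whose mass is at most linear in `s i`, and only if `s i > M`.
  have hfar : ∑ w ∈ h.words (x - M), wordWeight q w * h.tail (x - wordArea s w) ≤ 1 / 2 := by
    refine le_trans ?_ htail
    have hs1 : ∀ w ∈ h.words (x - M), HasSum
        (fun i => wordWeight q w * if x - wordArea s w < s i then q i else 0)
        (wordWeight q w * h.tail (x - wordArea s w)) := fun w _ => (h.hasSum_tail _).mul_left _
    have hs2 := hasSum_sum hs1
    refine hasSum_le (fun i => ?_) hs2 (Summable.hasSum ?_)
    · have e : ∑ w ∈ h.words (x - M), wordWeight q w * (if x - wordArea s w < s i then q i else 0)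
          = q i * h.mass (x - s i) (x - M) := by
        rw [mass, Finset.mul_sum, Finset.sum_filter]
        refine Finset.sum_congr rfl fun w _ => ?_
        by_cases hw : x - wordArea s w < s i
        · rw [if_pos hw, if_pos (by linarith), mul_comm]
        · rw [if_neg hw, if_neg (by linarith), mul_zero]
      rw [e]
      split_ifs with hi
      · refine mul_le_mul_of_nonneg_left ?_ (h.nonneg i)
        have := h.mass_le (x - M) (t := s i - M) (by linarith)
        rw [show x - M - (s i - M) = x - s i by ring] at this
        refine this.trans ?_
        have : (s i - M) / c ≤ s i / c := by
          have := h.pos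
          gcongr; linarith
        linarith
      · have : (h.words (x - M)).filter (x - s i < wordArea s ·) = ∅ := by
          ext w
          simp only [Finset.mem_filter, mem_words, Finset.notMem_empty, iff_false, not_and, not_lt]
          intro hw; linarith
        simp [mass, this]
    · refine Summable.of_nonneg_of_le (fun i => by split_ifs <;> simp [hg0]) (fun i => ?_) hgs
      split_ifs
      · exact le_rfl
      · exact hg0 i
  linarith

/-- The expected number of renewals in `[x - δ, x + δ]`. -/
noncomputable def closedMass (h : IsRenewal s q c) (δ x : ℝ) : ℝ :=
  ∑ w ∈ h.words (x + δ) with x - δ ≤ wordArea s w, wordWeight q w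

theorem closedMass_le (h : IsRenewal s q c) {δ : ℝ} (hδ : 0 < δ) (x : ℝ) :
    h.closedMass δ x ≤ (2 * δ + 1) / c + 1 := by
  -- The extra length `1` makes the half-open interval contain the left endpoint `x - δ`.
  have := h.mass_le (x + δ) (t := 2 * δ + 1) (by linarith)
  refine le_trans ?_ this
  refine Finset.sum_le_sum_of_subset_of_nonneg ?_ fun w _ _ => h.weight_nonneg w
  intro w hw
  simp only [Finset.mem_filter] at hw ⊢
  exact ⟨hw.1, by linarith [hw.2]⟩

/-- If finitely many words of positive weight come within `δ` of every large enough number, then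
windows of radius `δ` carry a definite mass. -/
theorem exists_le_closedMass (h : IsRenewal s q c) {δ : ℝ}
    (hW : ∃ T, 0 ≤ T ∧ ∀ M, 0 ≤ M → ∃ W : Finset (List ι), (∀ w ∈ W, 0 < wordWeight q w) ∧
      ∀ t, T ≤ t → t ≤ T + M → ∃ w ∈ W, |wordArea s w - t| ≤ δ) :
    ∃ ε, 0 < ε ∧ ∃ x₀, ∀ x, x₀ ≤ x → ε ≤ h.closedMass δ x := by
  classical
  obtain ⟨M, hM0, hM⟩ := h.exists_half_le_mass
  obtain ⟨T, hT0, hT⟩ := hW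
  obtain ⟨W, hWpos, hWt⟩ := hT M hM0
  -- Moving mass by the prefix `w` costs a factor `wordWeight q w`; `K` adds up the inverse costs
  -- over all available prefixes.
  set K : ℝ := ∑ w ∈ W, (wordWeight q w)⁻¹ with hK
  have hKpos : 0 < K := by
    obtain ⟨w, hw, -⟩ := hWt T le_rfl (by linarith)
    exact Finset.sum_pos (fun w hw => inv_pos.2 (hWpos w hw)) ⟨w, hw⟩
  refine ⟨1 / 2 / K, by positivity, T, fun x hx => ?_⟩
  rw [div_le_iff₀ hKpos]
  have h1 := hM (x - T) (by linarith)
  refine h1.trans ?_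
  -- Prefixing by a fixed `w` is injective and multiplies weights by `wordWeight q w`.
  have h2 : ∀ w ∈ W, ∑ J ∈ h.words (x - T) with |wordArea s w + wordArea s J - x| ≤ δ,
      wordWeight q J ≤ h.closedMass δ x * (wordWeight q w)⁻¹ := by
    intro w hw
    rw [le_mul_inv_iff₀ (hWpos w hw), Finset.sum_mul]
    calc _ = ∑ J ∈ ((h.words (x - T)).filter
              (fun J => |wordArea s w + wordArea s J - x| ≤ δ)).image (w ++ ·), wordWeight q J := by
            rw [Finset.sum_image (fun a _ b _ hab => List.append_cancel_left hab)]
            exact Finset.sum_congr rfl fun J _ => by simp [mul_comm]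
      _ ≤ _ := by
            refine Finset.sum_le_sum_of_subset_of_nonneg ?_ fun w _ _ => h.weight_nonneg w
            intro J' hJ'
            obtain ⟨J, hJ, rfl⟩ := Finset.mem_image.1 hJ'
            have := abs_le.1 (Finset.mem_filter.1 hJ).2
            simp only [Finset.mem_filter, mem_words, wordArea_append]
            constructor <;> linarith [this.1, this.2]
  rw [hK, Finset.mul_sum]
  refine le_trans ?_ (Finset.sum_le_sum h2)
  simp_rw [Finset.sum_filter]
  rw [Finset.sum_comm, mass, Finset.sum_filter]
  refine Finset.sum_le_sum fun J hJ => ?_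
  rw [mem_words] at hJ
  split_ifs with hJ'
  · obtain ⟨w, hw, hwt⟩ := hWt (x - wordArea s J) (by linarith) (by linarith)
    have hwt' : |wordArea s w + wordArea s J - x| ≤ δ := by
      rwa [show wordArea s w + wordArea s J - x = wordArea s w - (x - wordArea s J) by ring]
    calc wordWeight q J = if |wordArea s w + wordArea s J - x| ≤ δ then wordWeight q J else 0 := by
          rw [if_pos hwt']
      _ ≤ _ := Finset.single_le_sum (f := fun w =>
          if |wordArea s w + wordArea s J - x| ≤ δ then wordWeight q J else 0)
          (fun w _ => by split_ifs <;> simp [h.weight_nonneg]) hw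
  · exact Finset.sum_nonneg fun w _ => by split_ifs <;> simp [h.weight_nonneg]

end IsRenewal

/-- The additive semigroup generated by two positive numbers of irrational ratio is eventually
`δ`-dense. -/
theorem exists_nat_combination_near {p r : ℝ} (hp : 0 < p) (hr : 0 < r) (hpr : Irrational (p / r))
    {δ : ℝ} (hδ : 0 < δ) :
    ∃ T, 0 ≤ T ∧ ∀ t, T ≤ t → ∃ m n : ℕ, |m * p + n * r - t| ≤ δ := by
  obtain ⟨d, hd, hd0, hdδ⟩ : ∃ d ∈ AddSubgroup.closure {p, r}, 0 < d ∧ d < δ := by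
    obtain ⟨d, hd, hd'⟩ := (dense_addSubgroupClosure_pair_iff.2 hpr).exists_between hδ
    exact ⟨d, hd, hd'.1, hd'.2⟩
  obtain ⟨m, n, rfl⟩ := AddSubgroup.mem_closure_pair.1 hd
  -- `u` and `v` are combinations with natural coefficients whose difference is the small element
  -- `d`. The added `1` cancels in the difference and keeps `v` positive.
  set u : ℝ := (m.toNat + 1 : ℕ) * p + (n.toNat : ℕ) * r with hu
  set v : ℝ := ((-m).toNat + 1 : ℕ) * p + ((-n).toNat : ℕ) * r with hv
  have hm : (m : ℝ) = m.toNat - (-m).toNat := by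
    exact_mod_cast (Int.toNat_sub_toNat_neg m).symm
  have hn : (n : ℝ) = n.toNat - (-n).toNat := by
    exact_mod_cast (Int.toNat_sub_toNat_neg n).symm
  have huv : u - v = m • p + n • r := by
    simp only [zsmul_eq_mul, hm, hn, hu, hv]; push_cast; ring
  set d := m • p + n • r
  have hvpos : 0 < v := by rw [hv]; push_cast; positivity
  -- Among `K ≥ K₀` copies of `v`, replacing them one by one by `u` advances in steps of `d`, and `K
  -- * d > v` suffices to cross the gap from `K * v` to `(K + 1) * v`.
  obtain ⟨K₀, hK₀⟩ := exists_nat_gt (v / d)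
  rw [div_lt_iff₀ hd0] at hK₀
  refine ⟨K₀ * v, by positivity, fun t ht => ?_⟩
  have ht0 : 0 ≤ t := le_trans (by positivity) ht
  set K := ⌊t / v⌋₊ with hK
  have hK1 : K * v ≤ t := by
    rw [← le_div_iff₀ hvpos]; exact Nat.floor_le (by positivity)
  have hK2 : t < (K + 1) * v := by
    rw [← div_lt_iff₀ hvpos]; exact Nat.lt_floor_add_one _
  have hKK : K₀ ≤ K := Nat.le_floor (by rwa [le_div_iff₀ hvpos])
  set i := ⌊(t - K * v) / d⌋₊ with hi
  have hi1 : i * d ≤ t - K * v := by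
    rw [← le_div_iff₀ hd0]; exact Nat.floor_le (div_nonneg (by linarith) hd0.le)
  have hi2 : t - K * v < (i + 1) * d := by
    rw [← div_lt_iff₀ hd0]; exact Nat.lt_floor_add_one _
  have hiK : i ≤ K := by
    have : (i : ℝ) * d < K * d := by
      have : (K₀ : ℝ) * d ≤ K * d := by gcongr
      nlinarith
    exact_mod_cast (lt_of_mul_lt_mul_right this hd0.le).le
  refine ⟨(K - i) * ((-m).toNat + 1) + i * (m.toNat + 1), (K - i) * (-n).toNat + i * n.toNat, ?_⟩
  have e : (((K - i) * ((-m).toNat + 1) + i * (m.toNat + 1) : ℕ) : ℝ) * p +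
      (((K - i) * (-n).toNat + i * n.toNat : ℕ) : ℝ) * r = K * v + i * d := by
    rw [← huv, hu, hv]; push_cast [Nat.cast_sub hiK]; ring
  rw [e, abs_le]
  constructor <;> linarith

theorem wordArea_replicate {s : ι → ℝ} (n : ℕ) (i : ι) :
    wordArea s (List.replicate n i) = n * s i := by simp [wordArea]

theorem wordWeight_replicate {q : ι → ℝ} (n : ℕ) (i : ι) :
    wordWeight q (List.replicate n i) = q i ^ n := by simp [wordWeight]

theorem IsRenewal.exists_le_closedMass_of_irrational {s q : ι → ℝ} {c : ℝ} (h : IsRenewal s q c)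
    {δ : ℝ} (hδ : 0 < δ) {k l : ι} (hk : 0 < q k) (hl : 0 < q l) (hkl : Irrational (s k / s l)) :
    ∃ ε, 0 < ε ∧ ∃ x₀, ∀ x, x₀ ≤ x → ε ≤ h.closedMass δ x := by
  classical
  refine h.exists_le_closedMass ?_
  obtain ⟨T, hT0, hT⟩ := exists_nat_combination_near (h.step_pos k) (h.step_pos l) hkl hδ
  refine ⟨T, hT0, fun M hM => ?_⟩
  have hc := h.pos
  -- Near a `t ≤ T + M` the total area is at most `T + M + δ`, so neither letter occurs more than
  -- `B` times and a finite box of words serves every `t`.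
  set B := ⌈(T + M + δ) / c⌉₊ with hB
  have hB' : T + M + δ ≤ B * c := by
    rw [← div_le_iff₀ hc]; exact Nat.le_ceil _
  refine ⟨(Finset.range (B + 1) ×ˢ Finset.range (B + 1)).image
    fun mn => List.replicate mn.1 k ++ List.replicate mn.2 l, ?_, ?_⟩
  · intro w hw
    obtain ⟨mn, -, rfl⟩ := Finset.mem_image.1 hw
    simp only [wordWeight_append, wordWeight_replicate]
    positivity
  · intro t ht1 ht2
    obtain ⟨m, n, hmn⟩ := hT t ht1
    have hmn' := (abs_le.1 hmn).2
    have hm : (m : ℝ) * c ≤ m * s k := by gcongr; exact h.le_step k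
    have hn : (n : ℝ) * c ≤ n * s l := by gcongr; exact h.le_step l
    have hm0 : 0 ≤ (m : ℝ) * c := by positivity
    have hn0 : 0 ≤ (n : ℝ) * c := by positivity
    refine ⟨List.replicate m k ++ List.replicate n l, Finset.mem_image.2 ⟨(m, n), ?_, rfl⟩, ?_⟩
    · have h1 : (m : ℝ) ≤ B := le_of_mul_le_mul_right (by linarith) hc
      have h2 : (n : ℝ) ≤ B := le_of_mul_le_mul_right (by linarith) hc
      have h1' : m ≤ B := by exact_mod_cast h1
      have h2' : n ≤ B := by exact_mod_cast h2
      simp only [Finset.mem_product, Finset.mem_range]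
      omega
    · simpa [wordArea_replicate] using hmn

end Renewal

/-! ## The area law -/

theorem half_le_spinArea (k : ℕ) : (k : ℝ) / 2 ≤ spinArea k := by
  refine Real.le_sqrt_of_sq_le ?_
  simp only [spin]
  nlinarith [Nat.cast_nonneg (α := ℝ) k]

theorem spinArea_pos {k : ℕ} (hk : 1 ≤ k) : 0 < spinArea k := by
  have h1 : (1 : ℝ) ≤ k := by exact_mod_cast hk
  linarith [half_le_spinArea k]

theorem half_le_spinArea_pnat (k : ℕ+) : 1 / 2 ≤ spinArea k := by
  have h1 : (1 : ℝ) ≤ (k : ℕ) := by exact_mod_cast k.pos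
  linarith [half_le_spinArea k]

theorem finite_spinArea_le (x : ℝ) : {k : ℕ+ | spinArea k ≤ x}.Finite := by
  refine Set.Finite.subset (Set.finite_Iic (Nat.succPNat ⌊2 * x⌋₊)) ?_
  intro k hk
  have h1 := (half_le_spinArea k).trans hk
  have h2 : (k : ℕ) ≤ ⌊2 * x⌋₊ := Nat.le_floor (by linarith)
  rw [Set.mem_Iic, ← PNat.coe_le_coe]
  rw [Nat.succPNat_coe]
  omega

/-- The word of spins of a profile. -/
def SpinProfile.word (J : SpinProfile) : List ℕ+ := List.ofFn J.2

theorem SpinProfile.word_injective : Function.Injective SpinProfile.word := by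
  rintro ⟨⟨N, hN⟩, f⟩ ⟨⟨N', hN'⟩, f'⟩ h
  have h' := List.ofFn_inj'.1 h
  simp only [PNat.mk_coe] at h'
  obtain ⟨h1, h2⟩ := Sigma.mk.inj_iff.1 h'
  obtain rfl : N = N' := h1
  rw [eq_of_heq h2]

theorem SpinProfile.exists_word_eq {w : List ℕ+} (hw : w ≠ []) : ∃ J : SpinProfile, J.word = w :=
  ⟨⟨⟨w.length, List.length_pos_iff.2 hw⟩, w.get⟩, List.ofFn_get w⟩

/-- The unit of area. -/
noncomputable def areaUnit (γ ℓ : ℝ) : ℝ := 8 * Real.pi * γ * ℓ ^ 2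

theorem areaUnit_pos {γ ℓ : ℝ} (hγ : 0 < γ) (hℓ : 0 < ℓ) : 0 < areaUnit γ ℓ := by
  have := Real.pi_pos
  unfold areaUnit; positivity

theorem profileArea_eq (γ ℓ : ℝ) (J : SpinProfile) :
    profileArea γ ℓ J = areaUnit γ ℓ * wordArea (fun k : ℕ+ => spinArea k) J.word := by
  simp [profileArea, areaUnit, wordArea, SpinProfile.word, List.map_ofFn, List.sum_ofFn]

theorem window_finite {γ ℓ : ℝ} (hγ : 0 < γ) (hℓ : 0 < ℓ) (Ar Δ : ℝ) :
    (window γ ℓ Ar Δ).Finite := by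
  have hu := areaUnit_pos hγ hℓ
  refine Set.Finite.of_injOn (f := SpinProfile.word) ?_ SpinProfile.word_injective.injOn
    (finite_wordArea_le (s := fun k : ℕ+ => spinArea k) (c := 1 / 2) (by norm_num)
      half_le_spinArea_pnat finite_spinArea_le ((Ar + Δ) / areaUnit γ ℓ))
  intro J hJ
  have h1 : profileArea γ ℓ J ≤ Ar + Δ := hJ.2
  rw [profileArea_eq] at h1
  rw [Set.mem_ofPred_eq, le_div_iff₀ hu]
  linarith

theorem weightedCount_eq_sum {γ ℓ : ℝ} (hγ : 0 < γ) (hℓ : 0 < ℓ) (G : ℕ → ℝ) (Δ Ar : ℝ) :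
    weightedCount G γ ℓ Δ Ar =
      ∑ J ∈ (window_finite hγ hℓ Ar Δ).toFinset, ∏ i, G (J.2 i) :=
  finsum_mem_eq_finite_toFinset_sum _ _

theorem microCount_eq_weightedCount {γ ℓ : ℝ} (hγ : 0 < γ) (hℓ : 0 < ℓ) (Δ Ar : ℝ) :
    microCount γ ℓ Δ Ar = weightedCount (fun _ => 1) γ ℓ Δ Ar := by
  rw [weightedCount_eq_sum hγ hℓ, microCount, Set.ncard_eq_toFinset_card _ (window_finite hγ hℓ _ _)]
  simp

/-- Exponential tilting: the degeneracy of a word becomes its renewal probability times a factor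
that depends only on its area. -/
theorem wordWeight_mul_exp (G : ℕ → ℝ) (β : ℝ) (w : List ℕ+) :
    (w.map fun k : ℕ+ => G k).prod =
      wordWeight (fun k : ℕ+ => G k * Real.exp (-β * spinArea k)) w *
        Real.exp (β * wordArea (fun k : ℕ+ => spinArea k) w) := by
  induction w with
  | nil => simp
  | cons k w ih =>
    rw [List.map_cons, List.prod_cons, ih, wordWeight_cons, wordArea_cons, mul_add, Real.exp_add,
      neg_mul, Real.exp_neg]
    field_simp

theorem SolvesBeta.isRenewal {G : ℕ → ℝ} (hG : ∀ k, 1 ≤ k → 0 ≤ G k) {β : ℝ}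
    (hβ : SolvesBeta G β)
    (hmean : Summable (fun k : ℕ+ => spinArea k * (G k * Real.exp (-β * spinArea k)))) :
    IsRenewal (fun k : ℕ+ => spinArea k) (fun k : ℕ+ => G k * Real.exp (-β * spinArea k))
      (1 / 2) where
  pos := by norm_num
  le_step := half_le_spinArea_pnat
  finite_step := finite_spinArea_le
  nonneg k := mul_nonneg (hG k k.pos) (Real.exp_pos _).le
  hasSum := hβ
  mean := hmean

theorem weightedCount_eq_sum_words {γ ℓ : ℝ} (hγ : 0 < γ) (hℓ : 0 < ℓ) {G : ℕ → ℝ} {β : ℝ}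
    {s q : ℕ+ → ℝ} {c : ℝ} (h : IsRenewal s q c) (hs : s = fun k : ℕ+ => spinArea k)
    (hq : q = fun k : ℕ+ => G k * Real.exp (-β * spinArea k)) {Δ Ar : ℝ} (hAr : Δ < Ar) :
    weightedCount G γ ℓ Δ Ar =
      ∑ w ∈ h.words (Ar / areaUnit γ ℓ + Δ / areaUnit γ ℓ)
        with Ar / areaUnit γ ℓ - Δ / areaUnit γ ℓ ≤ wordArea s w,
        wordWeight q w * Real.exp (β * wordArea s w) := by
  have hu := areaUnit_pos hγ hℓ
  subst hs hq
  rw [weightedCount_eq_sum hγ hℓ]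
  refine Finset.sum_bij (fun J _ => J.word) ?_ ?_ ?_ ?_
  · intro J hJ
    rw [Set.Finite.mem_toFinset] at hJ
    have h1 : Ar - Δ ≤ profileArea γ ℓ J := hJ.1
    have h2 : profileArea γ ℓ J ≤ Ar + Δ := hJ.2
    rw [profileArea_eq] at h1 h2
    simp only [Finset.mem_filter, IsRenewal.mem_words]
    rw [← add_div, ← sub_div, le_div_iff₀ hu, div_le_iff₀ hu]
    constructor <;> linarith
  · intro J _ J' _ hJJ'
    exact SpinProfile.word_injective hJJ'
  · intro w hw
    simp only [Finset.mem_filter, IsRenewal.mem_words] at hw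
    rw [← add_div, ← sub_div, le_div_iff₀ hu, div_le_iff₀ hu] at hw
    -- The empty word is not a profile; `Δ < Ar` keeps it out of the window.
    have hne : w ≠ [] := by
      rintro rfl
      simp only [wordArea_nil, zero_mul] at hw
      linarith [hw.2]
    obtain ⟨J, rfl⟩ := SpinProfile.exists_word_eq hne
    refine ⟨J, ?_, rfl⟩
    rw [Set.Finite.mem_toFinset]
    refine ⟨?_, ?_⟩ <;> rw [profileArea_eq] <;> linarith [hw.1, hw.2]
  · intro J _
    rw [← wordWeight_mul_exp]
    simp [SpinProfile.word, List.map_ofFn, List.prod_ofFn]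

theorem SolvesBeta.areaLaw {γ ℓ Δ : ℝ} (hγ : 0 < γ) (hℓ : 0 < ℓ) (hΔ : 0 < Δ) {G : ℕ → ℝ}
    (hG : ∀ k, 1 ≤ k → 0 ≤ G k)
    (hirr : ∃ k l, 1 ≤ k ∧ 1 ≤ l ∧ 0 < G k ∧ 0 < G l ∧ Irrational (spinArea k / spinArea l))
    {β : ℝ} (hβ : SolvesBeta G β)
    (hmean : Summable (fun k : ℕ+ => spinArea k * (G k * Real.exp (-β * spinArea k)))) :
    AreaLaw γ ℓ β (weightedCount G γ ℓ Δ) := by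
  have hu := areaUnit_pos hγ hℓ
  have h := hβ.isRenewal hG hmean
  set δ := Δ / areaUnit γ ℓ with hδ
  have hδ0 : 0 < δ := div_pos hΔ hu
  obtain ⟨k, l, hk, hl, hGk, hGl, hkl⟩ := hirr
  obtain ⟨ε, hε, x₀, hx₀⟩ := h.exists_le_closedMass_of_irrational hδ0 (k := ⟨k, hk⟩) (l := ⟨l, hl⟩)
    (mul_pos hGk (Real.exp_pos _)) (mul_pos hGl (Real.exp_pos _)) hkl
  set C : ℝ := (2 * δ + 1) / (1 / 2) + 1 with hC
  -- Across the window the exponent `β * area` varies by at most `|β| * δ`, so the count is the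
  -- renewal mass times one exponential, up to constant factors.
  have key : ∀ᶠ Ar in Filter.atTop,
      ε * Real.exp (β * (Ar / areaUnit γ ℓ) - |β| * δ) ≤ weightedCount G γ ℓ Δ Ar ∧
      weightedCount G γ ℓ Δ Ar ≤ C * Real.exp (β * (Ar / areaUnit γ ℓ) + |β| * δ) := by
    filter_upwards [Filter.eventually_gt_atTop Δ,
      Filter.eventually_ge_atTop (x₀ * areaUnit γ ℓ)] with Ar h1 h2
    set x := Ar / areaUnit γ ℓ with hx
    have hx₀x : x₀ ≤ x := (le_div_iff₀ hu).2 h2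
    have hlow := hx₀ x hx₀x
    have hupp := h.closedMass_le hδ0 x
    rw [weightedCount_eq_sum_words hγ hℓ h rfl rfl h1]
    have hdev : ∀ w ∈ (h.words (x + δ)).filter
        (x - δ ≤ wordArea (fun k : ℕ+ => spinArea k) ·),
        |β * wordArea (fun k : ℕ+ => spinArea k) w - β * x| ≤ |β| * δ := by
      intro w hw
      simp only [Finset.mem_filter, IsRenewal.mem_words] at hw
      rw [← mul_sub, abs_mul]
      refine mul_le_mul_of_nonneg_left ?_ (abs_nonneg _)
      rw [abs_le]
      constructor <;> linarith [hw.1, hw.2]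
    constructor
    · refine (mul_le_mul_of_nonneg_right hlow (Real.exp_pos _).le).trans ?_
      rw [IsRenewal.closedMass, Finset.sum_mul]
      refine Finset.sum_le_sum fun w hw => ?_
      refine mul_le_mul_of_nonneg_left (Real.exp_le_exp.2 ?_) (h.weight_nonneg w)
      linarith [(abs_le.1 (hdev w hw)).1]
    · refine le_trans ?_ (mul_le_mul_of_nonneg_right hupp (Real.exp_pos _).le)
      rw [IsRenewal.closedMass, Finset.sum_mul]
      refine Finset.sum_le_sum fun w hw => ?_
      refine mul_le_mul_of_nonneg_left (Real.exp_le_exp.2 ?_) (h.weight_nonneg w)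
      linarith [(abs_le.1 (hdev w hw)).2]
  have hC0 : 0 < C := by positivity
  refine ⟨?_, ?_⟩
  · filter_upwards [key] with Ar h1
    exact lt_of_lt_of_le (by positivity) h1.1
  · refine Asymptotics.IsBigO.of_bound (|β| * δ + |Real.log ε| + |Real.log C|) ?_
    filter_upwards [key] with Ar h1
    have hpos : 0 < weightedCount G γ ℓ Δ Ar := lt_of_lt_of_le (by positivity) h1.1
    have hl1 := Real.log_le_log (by positivity) h1.1
    have hl2 := Real.log_le_log hpos h1.2
    rw [Real.log_mul hε.ne' (Real.exp_pos _).ne', Real.log_exp] at hl1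
    rw [Real.log_mul hC0.ne' (Real.exp_pos _).ne', Real.log_exp] at hl2
    have e : β / (8 * Real.pi * γ * ℓ ^ 2) * Ar = β * (Ar / areaUnit γ ℓ) := by
      rw [areaUnit]; ring
    rw [e, Real.norm_eq_abs, norm_one, mul_one, abs_le]
    have a1 := neg_abs_le (Real.log ε)
    have a2 := le_abs_self (Real.log C)
    have a3 := abs_nonneg (Real.log ε)
    have a4 := abs_nonneg (Real.log C)
    constructor <;> linarith

/-- Each term is nonincreasing in `β`, and strictly decreasing where `G k ≠ 0`; such a `k` exists
because the sum is one. -/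
theorem SolvesBeta.unique {G : ℕ → ℝ} (hG : ∀ k, 1 ≤ k → 0 ≤ G k) {β β' : ℝ}
    (hβ : SolvesBeta G β) (hβ' : SolvesBeta G β') : β' = β := by
  have key : ∀ {b b' : ℝ}, SolvesBeta G b → SolvesBeta G b' → ¬ b < b' := by
    intro b b' hb hb' hlt
    obtain ⟨k, hk⟩ : ∃ k : ℕ+, G k ≠ 0 := by
      by_contra! h0
      have : (fun k : ℕ+ => G k * Real.exp (-b * spinArea k)) = fun _ => 0 := by
        funext k; simp [h0]
      rw [SolvesBeta, this] at hb
      exact zero_ne_one (hasSum_zero.unique hb)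
    have hlt' : ∀ k : ℕ+, Real.exp (-b' * spinArea k) < Real.exp (-b * spinArea k) := fun k => by
      have := spinArea_pos k.pos
      rw [Real.exp_lt_exp]; nlinarith
    refine lt_irrefl (1 : ℝ) (hasSum_lt (fun k => ?_) (i := k) ?_ hb' hb)
    · exact mul_le_mul_of_nonneg_left (hlt' k).le (hG k k.pos)
    · exact mul_lt_mul_of_pos_left (hlt' k) (lt_of_le_of_ne (hG k k.pos) hk.symm)
  exact le_antisymm (not_lt.1 (key hβ hβ')) (not_lt.1 (key hβ' hβ))

/-! ## Numerical solution of the equation for `β` -/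

/-- The partition function of a single puncture. -/
noncomputable def punctureSum (G : ℕ → ℝ) (β : ℝ) : ℝ :=
  ∑' m : ℕ, G (m + 1) * Real.exp (-β * spinArea (m + 1))

theorem spinArea_succ (m : ℕ) : spinArea (m + 1) = √(((m : ℝ) + 2) ^ 2 - 1) / 2 := by
  rw [spinArea, eq_div_iff two_ne_zero]
  conv_lhs => rw [← Real.sqrt_sq (zero_le_two (α := ℝ))]
  rw [← Real.sqrt_mul' _ (by positivity)]
  congr 1
  simp only [spin]; push_cast; ring

theorem spinArea_succ_le (m : ℕ) : spinArea (m + 1) ≤ ((m : ℝ) + 2) / 2 := by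
  rw [spinArea_succ]
  gcongr
  exact Real.sqrt_le_iff.2 ⟨by positivity, by linarith⟩

/-- For `G k ≤ k + 1` the quadratic factor dominates both `G` and `spinArea * G`, so one majorant
serves the partition function and the mean. -/
theorem summable_mul_exp_spinArea {β : ℝ} (hβ : 0 < β) :
    Summable fun m : ℕ => ((m : ℝ) + 2) ^ 2 * Real.exp (-β * spinArea (m + 1)) := by
  have hr : ‖Real.exp (-β / 2)‖ < 1 := by
    rw [Real.norm_eq_abs, abs_of_pos (Real.exp_pos _), Real.exp_lt_one_iff]
    linarith
  have h1 : Summable fun n : ℕ => (n : ℝ) ^ 2 * Real.exp (-β / 2) ^ n :=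
    summable_pow_mul_geometric_of_norm_lt_one 2 hr
  have h2 : Summable fun m : ℕ => ((m + 2 : ℕ) : ℝ) ^ 2 * Real.exp (-β / 2) ^ (m + 2) :=
    h1.comp_injective (add_left_injective 2)
  refine Summable.of_nonneg_of_le (fun m => by positivity) (fun m => ?_)
    (h2.mul_left (Real.exp (β / 2)))
  have e : Real.exp (β / 2) * (((m + 2 : ℕ) : ℝ) ^ 2 * Real.exp (-β / 2) ^ (m + 2)) =
      ((m : ℝ) + 2) ^ 2 * Real.exp (β / 2 + ((m + 2 : ℕ) : ℝ) * (-β / 2)) := by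
    rw [Real.exp_add, Real.exp_nat_mul]; push_cast; ring
  rw [e]
  refine mul_le_mul_of_nonneg_left (Real.exp_le_exp.2 ?_) (by positivity)
  have := half_le_spinArea (m + 1)
  push_cast at this ⊢
  nlinarith

/-! ### Existence of the root by the intermediate value theorem -/

section Existence

variable {G : ℕ → ℝ}

theorem summable_mean (hG0 : ∀ k, 1 ≤ k → 0 ≤ G k) (hG : ∀ k, G k ≤ k + 1) {β : ℝ} (hβ : 0 < β) :
    Summable (fun k : ℕ+ => spinArea k * (G k * Real.exp (-β * spinArea k))) := by
  rw [← Equiv.pnatEquivNat.symm.summable_iff]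
  refine Summable.of_nonneg_of_le (fun m => ?_) (fun m => ?_) (summable_mul_exp_spinArea hβ)
  · have := hG0 (m + 1) (Nat.succ_pos m)
    have := (spinArea_pos (Nat.succ_pos m)).le
    simp only [Function.comp, Equiv.pnatEquivNat_symm_apply, Nat.succPNat_coe]
    positivity
  · have h0 := hG0 (m + 1) (Nat.succ_pos m)
    have h1 := (spinArea_pos (Nat.succ_pos m)).le
    have h2 := spinArea_succ_le m
    have h3 := hG (m + 1)
    push_cast at h3
    simp only [Function.comp, Equiv.pnatEquivNat_symm_apply, Nat.succPNat_coe, Nat.succ_eq_add_one]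
    rw [← mul_assoc]
    refine mul_le_mul_of_nonneg_right ?_ (Real.exp_pos _).le
    nlinarith [Nat.cast_nonneg (α := ℝ) m]

theorem summable_punctureSum (hG0 : ∀ k, 1 ≤ k → 0 ≤ G k) (hG : ∀ k, G k ≤ k + 1) {β : ℝ}
    (hβ : 0 < β) : Summable fun m : ℕ => G (m + 1) * Real.exp (-β * spinArea (m + 1)) := by
  refine Summable.of_nonneg_of_le (fun m => mul_nonneg (hG0 _ (Nat.succ_pos m)) (Real.exp_pos _).le)
    (fun m => ?_) (summable_mul_exp_spinArea hβ)
  have h3 := hG (m + 1)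
  push_cast at h3
  refine mul_le_mul_of_nonneg_right ?_ (Real.exp_pos _).le
  nlinarith [Nat.cast_nonneg (α := ℝ) m]

/-- The terms at `lo` dominate those on the whole interval, which makes the sum continuous there. -/
theorem exists_solvesBeta_between (hG0 : ∀ k, 1 ≤ k → 0 ≤ G k) (hG : ∀ k, G k ≤ k + 1) {lo hi : ℝ}
    (hlo0 : 0 < lo) (hlohi : lo ≤ hi) (hlo : 1 < punctureSum G lo) (hhi : punctureSum G hi < 1) :
    ∃ β, lo < β ∧ β < hi ∧ SolvesBeta G β := by
  have hcont : ContinuousOn (punctureSum G) (Set.Icc lo hi) := by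
    refine continuousOn_tsum (fun m => ?_) (summable_punctureSum hG0 hG hlo0) fun m β hβ => ?_
    · fun_prop
    · have h0 := hG0 (m + 1) (Nat.succ_pos m)
      rw [Real.norm_eq_abs, abs_of_nonneg (mul_nonneg h0 (Real.exp_pos _).le)]
      refine mul_le_mul_of_nonneg_left (Real.exp_le_exp.2 ?_) h0
      have := (spinArea_pos (Nat.succ_pos m)).le
      have := hβ.1
      simp only [Nat.succ_eq_add_one] at *
      nlinarith
  obtain ⟨β, hβ, hβ1⟩ := intermediate_value_Ioo' hlohi hcont ⟨hhi, hlo⟩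
  refine ⟨β, hβ.1, hβ.2, ?_⟩
  rw [SolvesBeta, ← Equiv.pnatEquivNat.symm.hasSum_iff, ← hβ1]
  exact (summable_punctureSum hG0 hG (hlo0.trans hβ.1)).hasSum

end Existence

/-- The seventh convergent, started at `v`, of the fixed-point equation `y = 1 / (2 x - y)` of
`y = x - √(x² - 1)`. -/
noncomputable def sqrtDefect (x v : ℝ) : ℝ :=
  1 / (2 * x - 1 / (2 * x - 1 / (2 * x - 1 / (2 * x - 1 / (2 * x - 1 / (2 * x -
    1 / (2 * x - v)))))))

/-! ### Rational bounds for `x - √(x² - 1)` -/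

section Defect

variable {x : ℝ}

/-- `x - √(x² - 1)` is the smaller root of `y² - 2xy + 1 = 0`, whose product with the other root is
one. -/
theorem sub_sqrt_eq (hx : 2 ≤ x) :
    x - √(x ^ 2 - 1) = 1 / (2 * x - (x - √(x ^ 2 - 1))) := by
  have h1 := Real.sq_sqrt (show 0 ≤ x ^ 2 - 1 by nlinarith)
  have h2 := Real.sqrt_nonneg (x ^ 2 - 1)
  rw [eq_div_iff (by linarith)]
  nlinarith

theorem sub_sqrt_nonneg (hx : 2 ≤ x) : 0 ≤ x - √(x ^ 2 - 1) :=
  sub_nonneg.2 (Real.sqrt_le_iff.2 ⟨by linarith, by linarith⟩)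

theorem sub_sqrt_le_half (hx : 2 ≤ x) : x - √(x ^ 2 - 1) ≤ 1 / 2 := by
  have : x - 1 / 2 ≤ √(x ^ 2 - 1) := Real.le_sqrt_of_sq_le (by nlinarith)
  linarith

/-- The map `v ↦ 1 / (2x - v)` is increasing below `2x`, so iterates started below its fixed point
stay below it. -/
theorem sqrtDefect_zero_le (hx : 2 ≤ x) : sqrtDefect x 0 ≤ x - √(x ^ 2 - 1) := by
  have step : ∀ v, v ≤ x - √(x ^ 2 - 1) → 1 / (2 * x - v) ≤ x - √(x ^ 2 - 1) := by
    intro v hv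
    rw [sub_sqrt_eq hx]
    have := sub_sqrt_le_half hx
    exact one_div_le_one_div_of_le (by linarith) (by linarith)
  exact step _ (step _ (step _ (step _ (step _ (step _ (step _ (sub_sqrt_nonneg hx)))))))

/-- The same monotonicity from above; the invariant `v ≤ 1` keeps the denominators positive. -/
theorem le_sqrtDefect_one (hx : 2 ≤ x) : x - √(x ^ 2 - 1) ≤ sqrtDefect x 1 := by
  have step : ∀ v, x - √(x ^ 2 - 1) ≤ v ∧ v ≤ 1 →
      x - √(x ^ 2 - 1) ≤ 1 / (2 * x - v) ∧ 1 / (2 * x - v) ≤ 1 := by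
    intro v hv
    constructor
    · rw [sub_sqrt_eq hx]
      exact one_div_le_one_div_of_le (by linarith [hv.2]) (by linarith [hv.1])
    · rw [div_le_one (by linarith [hv.2])]
      linarith [hv.2]
  have h0 : x - √(x ^ 2 - 1) ≤ 1 ∧ (1 : ℝ) ≤ 1 := ⟨by linarith [sub_sqrt_le_half hx], le_rfl⟩
  exact (step _ (step _ (step _ (step _ (step _ (step _ (step _ h0))))))).1

end Defect

/-- The Taylor polynomial of degree `7` of the exponential function. -/
noncomputable def expTaylor (z : ℝ) : ℝ :=
  1 + z + z ^ 2 / 2 + z ^ 3 / 6 + z ^ 4 / 24 + z ^ 5 / 120 + z ^ 6 / 720 + z ^ 7 / 5040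

theorem expTaylor_le {z : ℝ} (hz : 0 ≤ z) : expTaylor z ≤ Real.exp z := by
  refine le_of_eq_of_le ?_ (Real.sum_le_exp_of_nonneg hz 8)
  simp [expTaylor, Finset.sum_range_succ, Nat.factorial]

/-- The remainder constant is `9 / (8! * 8) = 1 / 35840`. -/
theorem le_expTaylor {z : ℝ} (hz : 0 ≤ z) (hz1 : z ≤ 1) :
    Real.exp z ≤ expTaylor z + z ^ 8 / 35840 := by
  refine (Real.exp_bound' hz hz1 (n := 8) (by norm_num)).trans_eq ?_
  simp [expTaylor, Finset.sum_range_succ, Nat.factorial]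
  ring

theorem expTaylor_mono {y z : ℝ} (hy : 0 ≤ y) (hyz : y ≤ z) : expTaylor y ≤ expTaylor z := by
  unfold expTaylor
  gcongr

/-- Splits off a geometric factor from a correction with exponent at most `β / 4`, small enough for
a short Taylor polynomial. -/
theorem exp_neg_mul_spinArea (β : ℝ) (m : ℕ) :
    Real.exp (-β * spinArea (m + 1)) = Real.exp (-(β / 2)) ^ (m + 2) *
      Real.exp (β / 2 * (((m : ℝ) + 2) - √(((m : ℝ) + 2) ^ 2 - 1))) := by
  rw [← Real.exp_nat_mul, ← Real.exp_add, spinArea_succ]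
  congr 1
  push_cast; ring

theorem le_exp_neg_mul_spinArea {β R : ℝ} (hβ : 0 ≤ β) (hR0 : 0 ≤ R)
    (hR : R ≤ Real.exp (-(β / 2))) (m : ℕ) :
    R ^ (m + 2) * expTaylor (β / 2 * sqrtDefect ((m : ℝ) + 2) 0) ≤
      Real.exp (-β * spinArea (m + 1)) := by
  have hx : (2 : ℝ) ≤ (m : ℝ) + 2 := by linarith [Nat.cast_nonneg (α := ℝ) m]
  rw [exp_neg_mul_spinArea]
  have h1 := sqrtDefect_zero_le hx
  have h0 : 0 ≤ sqrtDefect ((m : ℝ) + 2) 0 := by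
    have step : ∀ v : ℝ, 0 ≤ v ∧ v ≤ 1 → 0 ≤ 1 / (2 * ((m : ℝ) + 2) - v) ∧
        1 / (2 * ((m : ℝ) + 2) - v) ≤ 1 := by
      intro v hv
      have : 1 ≤ 2 * ((m : ℝ) + 2) - v := by linarith [hv.2]
      exact ⟨by positivity, (div_le_one (by linarith)).2 this⟩
    exact (step _ (step _ (step _ (step _ (step _ (step _ (step _ ⟨le_rfl, zero_le_one⟩))))))).1
  have h2 : 0 ≤ β / 2 * sqrtDefect ((m : ℝ) + 2) 0 := by positivity
  have h3 : β / 2 * sqrtDefect ((m : ℝ) + 2) 0 ≤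
      β / 2 * (((m : ℝ) + 2) - √(((m : ℝ) + 2) ^ 2 - 1)) := by gcongr
  refine mul_le_mul (pow_le_pow_left₀ hR0 hR _) ((expTaylor_le h2).trans (Real.exp_le_exp.2 h3))
    ((by unfold expTaylor; positivity)) (by positivity)

theorem exp_neg_mul_spinArea_le {β R : ℝ} (hβ : 0 ≤ β) (hβ2 : β ≤ 2)
    (hR : Real.exp (-(β / 2)) ≤ R) (m : ℕ) :
    Real.exp (-β * spinArea (m + 1)) ≤ R ^ (m + 2) *
      (expTaylor (β / 2 * sqrtDefect ((m : ℝ) + 2) 1) +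
        (β / 2 * sqrtDefect ((m : ℝ) + 2) 1) ^ 8 / 35840) := by
  have hx : (2 : ℝ) ≤ (m : ℝ) + 2 := by linarith [Nat.cast_nonneg (α := ℝ) m]
  rw [exp_neg_mul_spinArea]
  have h1 := le_sqrtDefect_one hx
  have h0 := sub_sqrt_nonneg hx
  have h2 := sub_sqrt_le_half hx
  set y := ((m : ℝ) + 2) - √(((m : ℝ) + 2) ^ 2 - 1)
  have h3 : 0 ≤ β / 2 * y := by positivity
  have h4 : β / 2 * y ≤ β / 2 * sqrtDefect ((m : ℝ) + 2) 1 := by gcongr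
  refine mul_le_mul (pow_le_pow_left₀ (Real.exp_pos _).le hR _) ?_ (Real.exp_pos _).le
    (pow_nonneg ((Real.exp_pos _).le.trans hR) _)
  refine (le_expTaylor h3 (by nlinarith)).trans (add_le_add (expTaylor_mono h3 h4) ?_)
  gcongr

/-- A crude bound for the tail of the series: the correction has exponent at most `1/2`, and `exp
(1/2) < 2`. -/
theorem exp_neg_mul_spinArea_le_two_mul {β R : ℝ} (hβ : 0 ≤ β) (hβ2 : β ≤ 2)
    (hR : Real.exp (-(β / 2)) ≤ R) (m : ℕ) :
    Real.exp (-β * spinArea (m + 1)) ≤ R ^ (m + 2) * 2 := by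
  have hx : (2 : ℝ) ≤ (m : ℝ) + 2 := by linarith [Nat.cast_nonneg (α := ℝ) m]
  rw [exp_neg_mul_spinArea]
  have h0 := sub_sqrt_nonneg hx
  have h2 := sub_sqrt_le_half hx
  refine mul_le_mul (pow_le_pow_left₀ (Real.exp_pos _).le hR _) ?_ (Real.exp_pos _).le
    (pow_nonneg ((Real.exp_pos _).le.trans hR) _)
  refine (le_expTaylor (by positivity) (by nlinarith)).trans ?_
  set z := β / 2 * (((m : ℝ) + 2) - √(((m : ℝ) + 2) ^ 2 - 1)) with hz
  have hz0 : 0 ≤ z := by positivity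
  have hz1 : z ≤ 1 / 2 := by rw [hz]; nlinarith
  calc expTaylor z + z ^ 8 / 35840 ≤ expTaylor (1 / 2) + (1 / 2) ^ 8 / 35840 := by
        refine add_le_add (expTaylor_mono hz0 hz1) ?_
        gcongr
    _ ≤ 2 := by norm_num [expTaylor]

theorem lt_punctureSum {G : ℕ → ℝ} (hG0 : ∀ k, 1 ≤ k → 0 ≤ G k) (hG : ∀ k, G k ≤ k + 1) {β R c : ℝ}
    (hβ : 0 < β) (hR0 : 0 ≤ R) (hR : R ≤ Real.exp (-(β / 2))) (N : ℕ)
    (hc : c < ∑ m ∈ Finset.range N,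
      G (m + 1) * (R ^ (m + 2) * expTaylor (β / 2 * sqrtDefect ((m : ℝ) + 2) 0))) :
    c < punctureSum G β := by
  refine hc.trans_le (le_trans (Finset.sum_le_sum fun m _ => ?_)
    ((summable_punctureSum hG0 hG hβ).sum_le_tsum _ fun m _ =>
      mul_nonneg (hG0 _ (Nat.succ_pos m)) (Real.exp_pos _).le))
  exact mul_le_mul_of_nonneg_left (le_exp_neg_mul_spinArea hβ.le hR0 hR m) (hG0 _ (Nat.succ_pos m))

/-- The first `N` terms take the sharp bound; the rest is compared with a geometric series, the `2`
in `2 * A` being the crude correction factor. -/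
theorem punctureSum_lt {G : ℕ → ℝ} (hG0 : ∀ k, 1 ≤ k → 0 ≤ G k) (hG : ∀ k, G k ≤ k + 1)
    {β R A r c : ℝ} (hβ : 0 < β) (hβ2 : β ≤ 2) (hR : Real.exp (-(β / 2)) ≤ R) (N : ℕ)
    (hr0 : 0 ≤ r) (hr1 : r < 1)
    (htail : ∀ j, G (j + N + 1) * R ^ (j + N + 2) ≤ A * r ^ j)
    (hc : ∑ m ∈ Finset.range N, G (m + 1) * (R ^ (m + 2) *
      (expTaylor (β / 2 * sqrtDefect ((m : ℝ) + 2) 1) +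
        (β / 2 * sqrtDefect ((m : ℝ) + 2) 1) ^ 8 / 35840)) + 2 * A * (1 - r)⁻¹ < c) :
    punctureSum G β < c := by
  have hs := summable_punctureSum hG0 hG hβ
  refine lt_of_le_of_lt ?_ hc
  rw [punctureSum, ← hs.sum_add_tsum_nat_add N]
  refine add_le_add (Finset.sum_le_sum fun m _ => mul_le_mul_of_nonneg_left
    (exp_neg_mul_spinArea_le hβ.le hβ2 hR m) (hG0 _ (Nat.succ_pos m))) ?_
  refine hasSum_le (fun j => ?_) ((summable_nat_add_iff N).2 hs).hasSum
    ((hasSum_geometric_of_lt_one hr0 hr1).mul_left (2 * A))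
  have h1 := mul_le_mul_of_nonneg_left (exp_neg_mul_spinArea_le_two_mul hβ.le hβ2 hR (j + N))
    (hG0 (j + N + 1) (Nat.succ_pos _))
  have h2 := htail j
  linarith

theorem exp_neg_le_of_one_le {x R : ℝ} (hx : 0 ≤ x) (hR : 0 ≤ R)
    (h : 1 ≤ R * ∑ i ∈ Finset.range 14, x ^ i / (i.factorial : ℝ)) : Real.exp (-x) ≤ R := by
  rw [Real.exp_neg, inv_le_iff_one_le_mul₀ (Real.exp_pos x)]
  exact h.trans (mul_le_mul_of_nonneg_left (Real.sum_le_exp_of_nonneg hx _) hR)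

theorem le_exp_neg_of_le_one {x R : ℝ} (hx : 0 ≤ x) (hx1 : x ≤ 1) (hR : 0 ≤ R)
    (h : R * (∑ i ∈ Finset.range 14, x ^ i / (i.factorial : ℝ) + x ^ 14 * 15 /
      ((Nat.factorial 14 : ℝ) * 14)) ≤ 1) : R ≤ Real.exp (-x) := by
  rw [Real.exp_neg, ← one_div, le_div_iff₀ (Real.exp_pos x)]
  refine (mul_le_mul_of_nonneg_left ?_ hR).trans h
  exact (Real.exp_bound' hx hx1 (n := 14) (by norm_num)).trans_eq (by norm_num)

theorem exists_solvesBeta_one :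
    ∃ β : ℝ, SolvesBeta (fun _ => 1) β ∧ 0 < β ∧ |β - 1.01527| < 0.000005 := by
  have hG0 : ∀ k : ℕ, 1 ≤ k → (0 : ℝ) ≤ (fun _ : ℕ => (1 : ℝ)) k := fun k _ => zero_le_one
  have hG : ∀ k : ℕ, (fun _ : ℕ => (1 : ℝ)) k ≤ k + 1 := fun k => by
    linarith [Nat.cast_nonneg (α := ℝ) k]
  -- The two `R` are rational bounds, from below for `exp (-lo / 2)` and from above for `exp (-hi /
  -- 2)`. The first omitted index is `34`, which gives the power `36` in `A`.
  obtain ⟨β, h1, h2, h3⟩ := exists_solvesBeta_between hG0 hG (lo := 1.01527) (hi := 1.015275)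
    (by norm_num) (by norm_num)
    (lt_punctureSum hG0 hG (R := 0.6019174314) (by norm_num) (by norm_num)
      (le_exp_neg_of_le_one (by norm_num) (by norm_num) (by norm_num) (by
        norm_num [Finset.sum_range_succ, Nat.factorial])) 34
      (by norm_num [Finset.sum_range_succ, sqrtDefect, expTaylor]))
    (punctureSum_lt hG0 hG (R := 0.6019159269) (A := 0.6019159269 ^ 36) (r := 0.6019159269)
      (by norm_num) (by norm_num)
      (exp_neg_le_of_one_le (by norm_num) (by norm_num) (by
        norm_num [Finset.sum_range_succ, Nat.factorial])) 34 (by norm_num) (by norm_num)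
      (fun j => by rw [one_mul, ← pow_add]; exact le_of_eq (congrArg _ (by ring)))
      (by norm_num [Finset.sum_range_succ, sqrtDefect, expTaylor]))
  refine ⟨β, h3, by linarith, abs_lt.2 ⟨by linarith, by linarith⟩⟩

theorem exists_solvesBeta_edge :
    ∃ β : ℝ, SolvesBeta (fun k => 2 * spin k + 1) β ∧ 0 < β ∧
      |β / (2 * Real.pi) - 0.274067| < 0.0000005 := by
  have e : ∀ k : ℕ, 2 * spin k + 1 = (k : ℝ) + 1 := fun k => by rw [spin]; ring
  simp only [e]
  have hG0 : ∀ k : ℕ, 1 ≤ k → 0 ≤ (fun k : ℕ => (k : ℝ) + 1) k := fun k _ => by positivity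
  have hG : ∀ k : ℕ, (fun k : ℕ => (k : ℝ) + 1) k ≤ k + 1 := fun k => le_rfl
  obtain ⟨β, h1, h2, h3⟩ := exists_solvesBeta_between hG0 hG (lo := 1.722011) (hi := 1.722015)
    (by norm_num) (by norm_num)
    (lt_punctureSum hG0 hG (R := 0.4227368066) (by norm_num) (by norm_num)
      (le_exp_neg_of_le_one (by norm_num) (by norm_num) (by norm_num) (by
        norm_num [Finset.sum_range_succ, Nat.factorial])) 24
      (by norm_num [Finset.sum_range_succ, sqrtDefect, expTaylor]))
    (punctureSum_lt hG0 hG (R := 0.4227359614) (A := 26 * 0.4227359614 ^ 26)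
      (r := 27 / 26 * 0.4227359614) (by norm_num) (by norm_num)
      (exp_neg_le_of_one_le (by norm_num) (by norm_num) (by
        norm_num [Finset.sum_range_succ, Nat.factorial])) 24 (by norm_num) (by norm_num)
      (fun j => by
        -- Bernoulli's inequality absorbs the linear degeneracy `j + 26` into the geometric ratio.
        have hb := one_add_mul_le_pow (a := (1 / 26 : ℝ)) (by norm_num) j
        have hj : ((j + 24 + 1 : ℕ) : ℝ) + 1 ≤ 26 * (27 / 26) ^ j := by
          push_cast; norm_num at hb ⊢; linarith
        calc _ ≤ 26 * (27 / 26) ^ j * (0.4227359614 : ℝ) ^ (j + 24 + 2) :=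
              mul_le_mul_of_nonneg_right hj (by positivity)
          _ = _ := by rw [mul_pow, pow_add, pow_add]; ring)
      (by norm_num [Finset.sum_range_succ, sqrtDefect, expTaylor]))
  -- The bracket for `β` is narrower than the target interval scaled by `2π`, leaving room for six
  -- digits of `π`.
  have hp1 := Real.pi_gt_d6
  have hp2 := Real.pi_lt_d6
  refine ⟨β, h3, by linarith, ?_⟩
  have hp : 0 < 2 * Real.pi := by linarith
  rw [abs_lt, neg_lt_sub_iff_lt_add, sub_lt_iff_lt_add, div_lt_iff₀ hp, ← sub_lt_iff_lt_add',
    lt_div_iff₀ hp]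
  constructor <;> nlinarith

/-- Spins `1/2` and `1` have areas `√3 / 2` and `√2`, with ratio `√6 / 4`. -/
theorem irrational_spinArea_ratio : Irrational (spinArea 1 / spinArea 2) := by
  have h1 : spinArea 1 / spinArea 2 = √6 / (4 : ℕ) := by
    rw [spinArea, spinArea, ← Real.sqrt_div' _ (by norm_num [spin]),
      ← Real.sqrt_sq (Nat.cast_nonneg (α := ℝ) 4), ← Real.sqrt_div' _ (by norm_num)]
    norm_num [spin]
  rw [h1]
  exact Irrational.div_natCast (by norm_num) (by norm_num)

theorem areaLaw_of_le_succ {γ ℓ Δ : ℝ} (hγ : 0 < γ) (hℓ : 0 < ℓ) (hΔ : 0 < Δ) {G : ℕ → ℝ}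
    (hG0 : ∀ k, 1 ≤ k → 0 < G k) (hG : ∀ k, G k ≤ k + 1) {β : ℝ} (hβ0 : 0 < β)
    (hβ : SolvesBeta G β) : AreaLaw γ ℓ β (weightedCount G γ ℓ Δ) :=
  hβ.areaLaw hγ hℓ hΔ (fun k hk => (hG0 k hk).le)
    ⟨1, 2, le_rfl, one_le_two, hG0 1 le_rfl, hG0 2 one_le_two, irrational_spinArea_ratio⟩
    (summable_mean (fun k hk => (hG0 k hk).le) hG hβ0)

/-! ## Functions of diagonalised matrices -/

section Diagonalised

variable {n : Type*} [Fintype n] [DecidableEq n]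

/-- The unitary `U` diagonalises `A`, with real eigenvalues `d`. -/
structure Diagonalises (U : Matrix n n ℂ) (d : n → ℝ) (A : Matrix n n ℂ) : Prop where
  mul_star : U * U.conjTranspose = 1
  eq : A = U * Matrix.diagonal (fun i => (d i : ℂ)) * U.conjTranspose

theorem Diagonalises.star_mul {U : Matrix n n ℂ} {d : n → ℝ} {A : Matrix n n ℂ}
    (h : Diagonalises U d A) : U.conjTranspose * U = 1 := mul_eq_one_comm.1 h.mul_star

theorem _root_.Matrix.IsHermitian.exists_diagonalises {A : Matrix n n ℂ} (hA : A.IsHermitian) :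
    ∃ U d, Diagonalises U d A :=
  ⟨hA.eigenvectorUnitary, hA.eigenvalues,
    by simpa [Matrix.star_eq_conjTranspose] using Unitary.coe_mul_star_self hA.eigenvectorUnitary,
    by
      conv_lhs => rw [hA.spectral_theorem]
      simp [Unitary.conjStarAlgAut_apply, Matrix.star_eq_conjTranspose, Function.comp_def]⟩

/-- The functions of the eigenvalues of a diagonalised matrix, as an algebra homomorphism. -/
noncomputable def conjDiagonal (U : Matrix n n ℂ) (hU : U * U.conjTranspose = 1) :
    (n → ℝ) →ₐ[ℝ] Matrix n n ℂ where
  toFun d := U * Matrix.diagonal (fun i => (d i : ℂ)) * U.conjTranspose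
  map_one' := by simp [hU]
  map_mul' d e := by
    have h : U.conjTranspose * U = 1 := mul_eq_one_comm.1 hU
    have : Matrix.diagonal (fun i => (((d * e) i : ℝ) : ℂ)) =
      Matrix.diagonal (fun i => (d i : ℂ)) * (U.conjTranspose * U) *
        Matrix.diagonal (fun i => (e i : ℂ)) := by
      rw [h]; simp [Matrix.diagonal_mul_diagonal]
    rw [this]
    simp only [Matrix.mul_assoc]
  map_zero' := by simp
  map_add' d e := by
    rw [← Matrix.add_mul, ← Matrix.mul_add, Matrix.diagonal_add]
    simp
  commutes' r := by
    have : (Matrix.diagonal fun _ : n => (r : ℂ)) = r • (1 : Matrix n n ℂ) := by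
      ext i j
      simp [Matrix.diagonal_apply, Matrix.one_apply, Matrix.smul_apply]
    simp only [Pi.algebraMap_apply, Algebra.algebraMap_self, RingHom.id_apply, this]
    rw [Matrix.mul_smul, Matrix.smul_mul, Matrix.mul_one, hU, Algebra.algebraMap_eq_smul_one]

/-- On the finite spectrum `f` agrees with an interpolation polynomial, and polynomials commute with
`conjDiagonal`. Continuity of `f` plays no role, so `Real.log` is allowed even with eigenvalue `0`.
-/
theorem Diagonalises.cfc {U : Matrix n n ℂ} {d : n → ℝ} {A : Matrix n n ℂ}
    (h : Diagonalises U d A) (f : ℝ → ℝ) : Diagonalises U (fun i => f (d i)) (cfc f A) := by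
  classical
  refine ⟨h.mul_star, ?_⟩
  have hA : A = conjDiagonal U h.mul_star d := h.eq
  have hsa : IsSelfAdjoint A := by
    rw [IsSelfAdjoint, h.eq, Matrix.star_eq_conjTranspose, Matrix.conjTranspose_mul,
      Matrix.conjTranspose_mul, Matrix.conjTranspose_conjTranspose, Matrix.diagonal_conjTranspose,
      Matrix.mul_assoc]
    congr 3
    funext i
    simp
  -- Algebra homomorphisms do not enlarge spectra, and the spectrum of `d` in `n → ℝ` is its set of
  -- values.
  have hspec : ∀ x ∈ spectrum ℝ A, ∃ i, d i = x := by
    intro x hx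
    rw [hA] at hx
    by_contra! hne
    refine AlgHom.spectrum_apply_subset (conjDiagonal U h.mul_star) d hx ?_
    rw [spectrum.mem_resolventSet_iff, Pi.isUnit_iff]
    intro i
    simpa [sub_eq_zero] using (hne i).symm
  set q : Polynomial ℝ := Lagrange.interpolate (Finset.univ.image d) id f with hq
  have hqd : ∀ i, q.eval (d i) = f (d i) := fun i =>
    Lagrange.eval_interpolate_at_node (v := id) f Function.injective_id.injOn
      (Finset.mem_image_of_mem d (Finset.mem_univ i))
  have h1 : _root_.cfc f A = _root_.cfc q.eval A := by
    refine cfc_congr fun x hx => ?_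
    obtain ⟨i, rfl⟩ := hspec x hx
    exact (hqd i).symm
  rw [h1, cfc_polynomial q A hsa, hA, Polynomial.aeval_algHom_apply]
  have h2 : Polynomial.aeval d q = fun i => f (d i) := by
    funext i
    rw [← hqd i]
    simp
  rw [h2]
  rfl

theorem Diagonalises.mul {U : Matrix n n ℂ} {d e : n → ℝ} {A B : Matrix n n ℂ}
    (hA : Diagonalises U d A) (hB : Diagonalises U e B) :
    Diagonalises U (fun i => d i * e i) (A * B) := by
  refine ⟨hA.mul_star, ?_⟩
  rw [hA.eq, hB.eq]
  exact ((conjDiagonal U hA.mul_star).map_mul d e).symm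

theorem Diagonalises.trace {U : Matrix n n ℂ} {d : n → ℝ} {A : Matrix n n ℂ}
    (h : Diagonalises U d A) : A.trace = ((∑ i, d i : ℝ) : ℂ) := by
  rw [h.eq, Matrix.trace_mul_comm, ← Matrix.mul_assoc, h.star_mul, Matrix.one_mul,
    Matrix.trace_diagonal]
  push_cast; rfl

theorem Diagonalises.congr_eigenvalues {U : Matrix n n ℂ} {d e : n → ℝ} {A : Matrix n n ℂ}
    (hd : Diagonalises U d A) (he : Diagonalises U e A) : d = e := by
  have h1 := hd.eq.symm.trans he.eq
  have h2 := congrArg (fun M => U.conjTranspose * M * U) h1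
  simp only [Matrix.mul_assoc, hd.star_mul, Matrix.mul_one] at h2
  simp only [← Matrix.mul_assoc, hd.star_mul, Matrix.one_mul] at h2
  funext i
  exact_mod_cast congrFun (Matrix.diagonal_injective h2) i

theorem Diagonalises.vonNeumann {U : Matrix n n ℂ} {d : n → ℝ} {A : Matrix n n ℂ}
    (h : Diagonalises U d A) : vonNeumann A = -∑ i, d i * Real.log (d i) := by
  rw [LQG.vonNeumann, (h.mul (h.cfc Real.log)).trace, Complex.ofReal_re]

/-- The eigenvalues are `0` or `1`, where `t log t` vanishes. -/
theorem vonNeumann_eq_zero_of_mul_self {A : Matrix n n ℂ} (hA : A.IsHermitian) (h : A * A = A) :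
    vonNeumann A = 0 := by
  obtain ⟨U, d, hd⟩ := hA.exists_diagonalises
  have h1 := hd.mul hd
  rw [h] at h1
  have h2 := hd.congr_eigenvalues h1
  rw [hd.vonNeumann, neg_eq_zero]
  refine Finset.sum_eq_zero fun i _ => ?_
  have h3 := congrFun h2 i
  rcases eq_or_ne (d i) 0 with h0 | h0
  · simp [h0]
  · have : d i = 1 := (mul_eq_left₀ h0).1 h3.symm
    simp [this]

end Diagonalised

/-! ## The entropy of a state with superselection sectors -/

section Components

variable {S : Type*} {a b : S → Type*} [∀ s, Fintype (b s)]

theorem partialTrace_block_pureDensity (Ψ : SumSpace a b) (s : S) :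
    partialTrace (block (pureDensity Ψ) s) = component Ψ s * (component Ψ s).conjTranspose := by
  ext i j
  simp [partialTrace, block, pureDensity, component, Matrix.mul_apply]

theorem component_mul_conjTranspose {Ψ : SumSpace a b} {s : S} {p : ℝ} (hp : 0 ≤ p)
    {ψ : Matrix (a s) (b s) ℂ} (h : component Ψ s = (√p : ℝ) • ψ) :
    component Ψ s * (component Ψ s).conjTranspose = p • (ψ * ψ.conjTranspose) := by
  rw [h, Matrix.conjTranspose_smul, Matrix.smul_mul, Matrix.mul_smul, smul_smul]
  simp [Real.mul_self_sqrt hp]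

variable [∀ s, Fintype (a s)]

theorem sectorProb_pureDensity (Ψ : SumSpace a b) (s : S) :
    sectorProb (pureDensity Ψ) s = ∑ i, ∑ k, ‖Ψ ⟨s, (i, k)⟩‖ ^ 2 := by
  rw [sectorProb, partialTrace_block_pureDensity, Matrix.trace, Complex.re_sum]
  refine Finset.sum_congr rfl fun i _ => ?_
  rw [Matrix.diag_apply, Matrix.mul_apply, Complex.re_sum]
  refine Finset.sum_congr rfl fun k _ => ?_
  rw [Matrix.conjTranspose_apply, component, Matrix.of_apply, ← starRingEnd_apply, Complex.mul_conj,
    Complex.ofReal_re, Complex.normSq_eq_norm_sq]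

theorem sectorProb_nonneg (Ψ : SumSpace a b) (s : S) : 0 ≤ sectorProb (pureDensity Ψ) s := by
  rw [sectorProb_pureDensity]
  positivity

theorem sectorProb_eq_zero_iff (Ψ : SumSpace a b) (s : S) :
    sectorProb (pureDensity Ψ) s = 0 ↔ component Ψ s = 0 := by
  rw [sectorProb_pureDensity, Finset.sum_eq_zero_iff_of_nonneg fun i _ => by positivity]
  constructor
  · intro h
    ext i k
    have := (Finset.sum_eq_zero_iff_of_nonneg fun k _ => by positivity).1 (h i (Finset.mem_univ i)) k
      (Finset.mem_univ k)
    simpa [component] using this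
  · intro h i _
    refine Finset.sum_eq_zero fun k _ => ?_
    have := congrFun (congrFun h i) k
    simp only [component, Matrix.of_apply, Matrix.zero_apply] at this
    simp [this]

theorem sectorProb_of_component {Ψ : SumSpace a b} {s : S} {p : ℝ} (hp : 0 ≤ p)
    {ψ : Matrix (a s) (b s) ℂ} (hψ : (ψ * ψ.conjTranspose).trace = 1)
    (h : component Ψ s = (√p : ℝ) • ψ) : sectorProb (pureDensity Ψ) s = p := by
  rw [sectorProb, partialTrace_block_pureDensity, component_mul_conjTranspose hp h,
    Matrix.trace_smul, hψ]
  simp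

theorem reducedDensity_of_component {Ψ : SumSpace a b} {s : S} {p : ℝ} (hp : 0 < p)
    {ψ : Matrix (a s) (b s) ℂ} (hψ : (ψ * ψ.conjTranspose).trace = 1)
    (h : component Ψ s = (√p : ℝ) • ψ) :
    reducedDensity (pureDensity Ψ) s = ψ * ψ.conjTranspose := by
  rw [reducedDensity, sectorProb_of_component hp.le hψ h, partialTrace_block_pureDensity,
    component_mul_conjTranspose hp.le h, smul_smul, inv_mul_cancel₀ hp.ne', one_smul]

theorem sum_sectorProb [Fintype S] (Ψ : SumSpace a b) : ∑ s, sectorProb (pureDensity Ψ) s = ‖Ψ‖ ^ 2 := by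
  rw [EuclideanSpace.norm_sq_eq, Fintype.sum_sigma]
  refine Finset.sum_congr rfl fun s _ => ?_
  rw [sectorProb_pureDensity, Fintype.sum_prod_type]

end Components

section Entropy

variable {S : Type*} [Fintype S] [DecidableEq S]
  {a b : S → Type*} [∀ s, Fintype (a s)] [∀ s, DecidableEq (a s)]
  [∀ s, Fintype (b s)] [∀ s, DecidableEq (b s)]

theorem Diagonalises.kronecker_one {m k : Type*} [Fintype m] [DecidableEq m] [Fintype k]
    [DecidableEq k] {U : Matrix m m ℂ} {d : m → ℝ} {A : Matrix m m ℂ} (h : Diagonalises U d A)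
    (c : ℝ) : Diagonalises (U ⊗ₖ (1 : Matrix k k ℂ)) (fun x : m × k => c * d x.1)
      (c • (A ⊗ₖ (1 : Matrix k k ℂ))) := by
  constructor
  · rw [Matrix.conjTranspose_kronecker, ← Matrix.mul_kronecker_mul, h.mul_star]
    simp
  · have e : Matrix.diagonal (fun x : m × k => ((c * d x.1 : ℝ) : ℂ)) =
        c • (Matrix.diagonal (fun i => (d i : ℂ)) ⊗ₖ (1 : Matrix k k ℂ)) := by
      rw [← Matrix.diagonal_one, Matrix.diagonal_kronecker_diagonal]
      ext x y
      simp [Matrix.diagonal_apply, Matrix.smul_apply]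
    rw [e, Matrix.mul_smul, Matrix.smul_mul, Matrix.conjTranspose_kronecker,
      ← Matrix.mul_kronecker_mul, ← Matrix.mul_kronecker_mul, ← h.eq]
    simp

theorem Diagonalises.blockDiagonal {m : S → Type*} [∀ s, Fintype (m s)] [∀ s, DecidableEq (m s)]
    {U A : ∀ s, Matrix (m s) (m s) ℂ} {d : ∀ s, m s → ℝ} (h : ∀ s, Diagonalises (U s) (d s) (A s)) :
    Diagonalises (Matrix.blockDiagonal' U) (fun x => d x.1 x.2) (Matrix.blockDiagonal' A) := by
  constructor
  · rw [Matrix.blockDiagonal'_conjTranspose, ← Matrix.blockDiagonal'_mul]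
    simp only [(h _).mul_star]
    exact Matrix.blockDiagonal'_one
  · have e : (Matrix.diagonal fun x : (s : S) × m s => (d x.1 x.2 : ℂ)) =
        Matrix.blockDiagonal' fun s => Matrix.diagonal fun i => (d s i : ℂ) :=
      (Matrix.blockDiagonal'_diagonal fun s i => (d s i : ℂ)).symm
    rw [e, Matrix.blockDiagonal'_conjTranspose, ← Matrix.blockDiagonal'_mul,
      ← Matrix.blockDiagonal'_mul]
    congr 1
    funext s
    exact (h s).eq

/-- Used to see that the logarithm acts block by block: both sides have the same diagonalisation. -/
theorem Diagonalises.unique {n : Type*} [Fintype n] [DecidableEq n] {U : Matrix n n ℂ} {d : n → ℝ}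
    {A B : Matrix n n ℂ} (hA : Diagonalises U d A) (hB : Diagonalises U d B) : A = B :=
  hA.eq.trans hB.eq.symm

/-- Block `s` has the eigenvalues `(p_s / λ_s) d_i`, each repeated `dim H_{B,s}` times. The trace
weight `λ_s / dim H_{B,s}` cancels the multiplicity, and the logarithm splits. -/
theorem entropy_eq_sum (lam : S → ℝ) (hlam : ∀ s, 0 < lam s)
    (ρ : Matrix (SumIndex a b) (SumIndex a b) ℂ)
    (hherm : ∀ s, (partialTrace (block ρ s)).IsHermitian) :
    entropy lam ρ = ∑ s, sectorProb ρ s *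
      (vonNeumann (reducedDensity ρ s) - Real.log (sectorProb ρ s / lam s)) := by
  have hred : ∀ s, (reducedDensity ρ s).IsHermitian := fun s => by
    rw [Matrix.IsHermitian, reducedDensity, Matrix.conjTranspose_smul, (hherm s).eq]
    simp
  choose U d hd using fun s => (hred s).exists_diagonalises
  set c : S → ℝ := fun s => sectorProb ρ s * (lam s)⁻¹ with hc
  have hV := fun s => (hd s).kronecker_one (k := b s) (c s)
  have h1 : Diagonalises _ _ (renDensity lam ρ) := Diagonalises.blockDiagonal hV
  have h2 := h1.mul (h1.cfc Real.log)
  have h3 : Diagonalises _ _ (Matrix.blockDiagonal' fun s =>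
      c s • (reducedDensity ρ s ⊗ₖ (1 : Matrix (b s) (b s) ℂ)) *
        cfc Real.log (c s • (reducedDensity ρ s ⊗ₖ (1 : Matrix (b s) (b s) ℂ)))) :=
    Diagonalises.blockDiagonal fun s => (hV s).mul ((hV s).cfc Real.log)
  have h4 := h2.unique h3
  rw [entropy, h4, renTrace]
  have hblock : ∀ (M : ∀ s, Matrix (a s × b s) (a s × b s) ℂ) (s : S),
      block (Matrix.blockDiagonal' M) s = M s := by
    intro M s
    ext x y
    simp [block]
  simp only [hblock]
  rw [Complex.re_sum, ← Finset.sum_neg_distrib]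
  refine Finset.sum_congr rfl fun s _ => ?_
  rw [((hV s).mul ((hV s).cfc Real.log)).trace, ← Complex.ofReal_mul, Complex.ofReal_re,
    Fintype.sum_prod_type]
  simp only [Finset.sum_const, Finset.card_univ, nsmul_eq_mul]
  rw [(hd s).vonNeumann]
  have hl := (hlam s).ne'
  -- An empty sector contributes zero whatever its `reducedDensity`. Otherwise `b s` is nonempty and
  -- the reduced density has trace one.
  rcases eq_or_ne (sectorProb ρ s) 0 with hp | hp
  · simp [hc, hp]
  have hb : (Fintype.card (b s) : ℝ) ≠ 0 := by
    intro h0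
    rw [Nat.cast_eq_zero, Fintype.card_eq_zero_iff] at h0
    exact hp (by simp [sectorProb, partialTrace, Matrix.trace])
  have htr : ∑ i, d s i = 1 := by
    have h5 := congrArg Complex.re (hd s).trace
    rw [Complex.ofReal_re] at h5
    rw [← h5, reducedDensity, Matrix.trace_smul, Complex.smul_re, smul_eq_mul]
    exact inv_mul_cancel₀ hp
  have hcp : c s ≠ 0 := mul_ne_zero hp (inv_ne_zero hl)
  have hterm : ∀ i, c s * d s i * Real.log (c s * d s i) =
      c s * Real.log (c s) * d s i + c s * (d s i * Real.log (d s i)) := by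
    intro i
    rcases eq_or_ne (d s i) 0 with h0 | h0
    · simp [h0]
    · rw [Real.log_mul hcp h0]; ring
  simp only [hterm]
  rw [← Finset.mul_sum, Finset.sum_add_distrib, ← Finset.mul_sum, ← Finset.mul_sum, htr]
  rw [div_eq_mul_inv (sectorProb ρ s)]
  change _ = sectorProb ρ s * (_ - Real.log (c s))
  have hcl : lam s * c s = sectorProb ρ s := by rw [hc]; field_simp
  rw [← hcl]
  field_simp
  ring

theorem entropy_pureDensity (lam : S → ℝ) (hlam : ∀ s, 0 < lam s) (Ψ : SumSpace a b) :
    entropy lam (pureDensity Ψ) = ∑ s, sectorProb (pureDensity Ψ) s *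
      (vonNeumann (reducedDensity (pureDensity Ψ) s) -
        Real.log (sectorProb (pureDensity Ψ) s / lam s)) :=
  entropy_eq_sum lam hlam _ fun s => by
    rw [partialTrace_block_pureDensity]
    exact Matrix.isHermitian_mul_conjTranspose_self _

/-- The matrix `B` is a multiple of `u u†`, so `B² = (Tr B) B`. -/
theorem vecMulVec_mul_conjTranspose_idempotent {m k : Type*} [Fintype m] [Fintype k]
    (u : m → ℂ) (v : k → ℂ)
    (h : (Matrix.vecMulVec u v * (Matrix.vecMulVec u v).conjTranspose).trace = 1) :
    (Matrix.vecMulVec u v * (Matrix.vecMulVec u v).conjTranspose) *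
      (Matrix.vecMulVec u v * (Matrix.vecMulVec u v).conjTranspose) =
      Matrix.vecMulVec u v * (Matrix.vecMulVec u v).conjTranspose := by
  set B := Matrix.vecMulVec u v * (Matrix.vecMulVec u v).conjTranspose with hB
  have e : ∀ i j, B i j = u i * star (u j) * ∑ k, v k * star (v k) := by
    intro i j
    simp only [hB, Matrix.mul_apply, Matrix.conjTranspose_apply, Matrix.vecMulVec_apply, star_mul',
      Finset.mul_sum]
    exact Finset.sum_congr rfl fun k _ => by ring
  have h1 : ∑ j, u j * star (u j) * ∑ k, v k * star (v k) = 1 := by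
    rw [← h, Matrix.trace]
    exact Finset.sum_congr rfl fun j _ => (e j j).symm
  ext i j
  rw [Matrix.mul_apply]
  calc ∑ x, B i x * B x j
      = ∑ x, (u i * star (u j) * ∑ k, v k * star (v k)) *
          (u x * star (u x) * ∑ k, v k * star (v k)) :=
        Finset.sum_congr rfl fun x _ => by rw [e, e]; ring
    _ = B i j := by rw [← Finset.mul_sum, h1, mul_one, e]

theorem vonNeumann_vecMulVec {m k : Type*} [Fintype m] [DecidableEq m] [Fintype k]
    (u : m → ℂ) (v : k → ℂ)
    (h : (Matrix.vecMulVec u v * (Matrix.vecMulVec u v).conjTranspose).trace = 1) :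
    vonNeumann (Matrix.vecMulVec u v * (Matrix.vecMulVec u v).conjTranspose) = 0 :=
  vonNeumann_eq_zero_of_mul_self (Matrix.isHermitian_mul_conjTranspose_self _)
    (vecMulVec_mul_conjTranspose_idempotent u v h)

end Entropy

/-! ## Product states -/

section PiProduct

variable {ι : Type*} [Fintype ι] {m k l : ι → Type*}

/-- The tensor product of a family of matrices. -/
def piProduct (M : ∀ i, Matrix (m i) (k i) ℂ) : Matrix (∀ i, m i) (∀ i, k i) ℂ :=
  Matrix.of fun x y => ∏ i, M i (x i) (y i)

theorem piProduct_conjTranspose (M : ∀ i, Matrix (m i) (k i) ℂ) :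
    (piProduct M).conjTranspose = piProduct fun i => (M i).conjTranspose := by
  ext x y
  simp [piProduct]

theorem piProduct_diagonal [∀ i, DecidableEq (m i)] (d : ∀ i, m i → ℂ) :
    piProduct (fun i => Matrix.diagonal (d i)) = Matrix.diagonal fun x => ∏ i, d i (x i) := by
  ext x y
  by_cases h : x = y
  · subst h; simp [piProduct]
  · obtain ⟨i, hi⟩ := Function.ne_iff.1 h
    rw [Matrix.diagonal_apply_ne _ h, piProduct, Matrix.of_apply]
    exact Finset.prod_eq_zero (Finset.mem_univ i) (Matrix.diagonal_apply_ne _ hi)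

variable [DecidableEq ι]

theorem piProduct_mul [∀ i, Fintype (k i)] (M : ∀ i, Matrix (m i) (k i) ℂ)
    (N : ∀ i, Matrix (k i) (l i) ℂ) :
    piProduct M * piProduct N = piProduct fun i => M i * N i := by
  ext x y
  simp only [piProduct, Matrix.mul_apply, Matrix.of_apply, Finset.prod_univ_sum,
    Fintype.piFinset_univ, Finset.prod_mul_distrib]

theorem trace_piProduct [∀ i, Fintype (m i)] (M : ∀ i, Matrix (m i) (m i) ℂ) :
    (piProduct M).trace = ∏ i, (M i).trace := by
  simp only [piProduct, Matrix.trace, Matrix.diag_apply, Matrix.of_apply, Finset.prod_univ_sum,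
    Fintype.piFinset_univ]

variable [∀ i, Fintype (m i)] [∀ i, DecidableEq (m i)]

theorem Diagonalises.piProduct {U A : ∀ i, Matrix (m i) (m i) ℂ} {d : ∀ i, m i → ℝ}
    (h : ∀ i, Diagonalises (U i) (d i) (A i)) :
    Diagonalises (piProduct U) (fun x => ∏ i, d i (x i)) (piProduct A) := by
  constructor
  · rw [piProduct_conjTranspose, piProduct_mul]
    simp only [(h _).mul_star, ← Matrix.diagonal_one, piProduct_diagonal, Finset.prod_const_one]
  · have e : (Matrix.diagonal fun x : ∀ i, m i => ((∏ i, d i (x i) : ℝ) : ℂ)) =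
        LQG.piProduct fun i => Matrix.diagonal fun j => (d i j : ℂ) := by
      rw [piProduct_diagonal]; simp
    rw [e, piProduct_conjTranspose, piProduct_mul, piProduct_mul]
    congr 1
    funext i
    exact (h i).eq

/-- The logarithm of a product eigenvalue is a sum over sites; in the term of site `i` the other
sites sum to their trace, one. -/
theorem vonNeumann_piProduct {A : ∀ i, Matrix (m i) (m i) ℂ} (hA : ∀ i, (A i).IsHermitian)
    (htr : ∀ i, (A i).trace = 1) : vonNeumann (piProduct A) = ∑ i, vonNeumann (A i) := by
  choose U d hd using fun i => (hA i).exists_diagonalises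
  have hsum : ∀ i, ∑ j, d i j = 1 := fun i => by
    have := (hd i).trace
    rw [htr] at this
    exact_mod_cast this.symm
  rw [(Diagonalises.piProduct hd).vonNeumann]
  simp only [(hd _).vonNeumann]
  rw [Finset.sum_neg_distrib, neg_inj]
  have hterm : ∀ x : ∀ i, m i, (∏ i, d i (x i)) * Real.log (∏ i, d i (x i)) =
      ∑ i, (∏ i, d i (x i)) * Real.log (d i (x i)) := by
    intro x
    by_cases h0 : ∏ i, d i (x i) = 0
    · simp [h0]
    · rw [Real.log_prod fun i _ => (Finset.prod_ne_zero_iff.1 h0) i (Finset.mem_univ i),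
        Finset.mul_sum]
  simp only [hterm]
  rw [Finset.sum_comm]
  refine Finset.sum_congr rfl fun i _ => ?_
  -- Placing the logarithm at site `i` alone turns the summand into a product over sites, so the sum
  -- over `x` factorises.
  set g : ∀ l, m l → ℝ := fun l y => d l y * if l = i then Real.log (d l y) else 1 with hg
  have h1 : ∀ x : ∀ i, m i, (∏ l, d l (x l)) * Real.log (d i (x i)) = ∏ l, g l (x l) := by
    intro x
    simp only [hg, Finset.prod_mul_distrib]
    rw [Finset.prod_ite_eq' Finset.univ i fun l => Real.log (d l (x l))]
    simp
  simp only [h1]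
  have h2 := Finset.prod_univ_sum (fun l => (Finset.univ : Finset (m l))) g
  rw [Fintype.piFinset_univ] at h2
  rw [← h2, ← Finset.mul_prod_erase _ _ (Finset.mem_univ i), Finset.prod_eq_one, mul_one]
  · simp [hg]
  · intro l hl
    simp [hg, Finset.ne_of_mem_erase hl, hsum]

end PiProduct

/-! ## Gibbs' inequality -/

/-- Gibbs' inequality for subnormalised weights, with the case of equality. -/
theorem gibbs_inequality {S : Type*} [Fintype S] {p w : S → ℝ} {D : ℝ} (hp : ∀ s, 0 ≤ p s)
    (hp1 : ∑ s, p s = 1) (hw : ∀ s, p s ≠ 0 → 0 < w s) (hD : ∑ s with p s ≠ 0, w s ≤ D) :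
    ∑ s, p s * (Real.log (w s) - Real.log (p s)) ≤ Real.log D ∧
      (∑ s, p s * (Real.log (w s) - Real.log (p s)) = Real.log D ↔
        ∀ s, p s = 0 ∨ p s = w s / D) := by
  have hD0 : 0 < D := by
    refine lt_of_lt_of_le (Finset.sum_pos (fun s hs => hw s (Finset.mem_filter.1 hs).2) ?_) hD
    by_contra hne
    rw [Finset.not_nonempty_iff_eq_empty, Finset.filter_eq_empty_iff] at hne
    have h0 : ∑ s, p s = 0 := Finset.sum_eq_zero fun s hs => not_not.1 (hne hs)
    exact one_ne_zero (hp1.symm.trans h0)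
  -- `t` is the summand with `log D` subtracted, and `u` its bound from `log y ≤ y - 1` at `y = w s
  -- / (D p s)`. Equality forces `y = 1`.
  set t : S → ℝ := fun s => p s * (Real.log (w s) - Real.log (p s) - Real.log D) with ht
  set u : S → ℝ := fun s => if p s ≠ 0 then w s / D - p s else 0 with hu
  have hsum : ∑ s, p s * (Real.log (w s) - Real.log (p s)) = Real.log D + ∑ s, t s := by
    simp only [ht, mul_sub _ (_ - _), Finset.sum_sub_distrib, ← Finset.sum_mul, hp1]
    ring
  have hlog : ∀ s, p s ≠ 0 → t s = p s * Real.log (w s / D / p s) := fun s hs => by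
    rw [Real.log_div (div_pos (hw s hs) hD0).ne' hs, Real.log_div (hw s hs).ne' hD0.ne']
    simp only [ht]; ring
  have htu : ∀ s, t s ≤ u s := by
    intro s
    by_cases hs : p s = 0
    · simp [ht, hu, hs]
    · have hps := lt_of_le_of_ne (hp s) (Ne.symm hs)
      have := Real.log_le_sub_one_of_pos (div_pos (div_pos (hw s hs) hD0) hps)
      rw [hlog s hs]
      simp only [hu, ne_eq, hs, not_false_eq_true, if_true]
      refine (mul_le_mul_of_nonneg_left this hps.le).trans_eq ?_
      field_simp
  have hteq : ∀ s, t s = u s → p s = 0 ∨ p s = w s / D := by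
    intro s hs
    by_contra! hne
    have hps := lt_of_le_of_ne (hp s) (Ne.symm hne.1)
    have := Real.log_lt_sub_one_of_pos (div_pos (div_pos (hw s hne.1) hD0) hps)
      (fun h => hne.2 ((div_eq_one_iff_eq hne.1).1 h).symm)
    rw [hlog s hne.1] at hs
    simp only [hu, ne_eq, hne.1, not_false_eq_true, if_true] at hs
    have h2 := mul_lt_mul_of_pos_left this hps
    rw [hs] at h2
    refine lt_irrefl _ (h2.trans_eq ?_)
    field_simp
  have hu0 : ∑ s, u s ≤ 0 := by
    have : ∑ s, u s = (∑ s with p s ≠ 0, w s) / D - 1 := by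
      rw [← hp1, Finset.sum_div, Finset.sum_filter, ← Finset.sum_sub_distrib]
      refine Finset.sum_congr rfl fun s _ => ?_
      by_cases hs : p s = 0 <;> simp [hu, hs]
    rw [this, sub_nonpos, div_le_one hD0]
    exact hD
  have htu' := Finset.sum_le_sum fun s (_ : s ∈ Finset.univ) => htu s
  rw [hsum]
  refine ⟨by linarith, ⟨fun h => ?_, fun h => ?_⟩⟩
  · have heq : ∑ s, t s = ∑ s, u s := le_antisymm htu' (by linarith)
    intro s
    exact hteq s ((Finset.sum_eq_sum_iff_of_le fun s _ => htu s).1 heq s (Finset.mem_univ s))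
  · have : ∑ s, t s = 0 := by
      refine Finset.sum_eq_zero fun s _ => ?_
      by_cases hs : p s = 0
      · simp [ht, hs]
      · rw [hlog s hs, ← (h s).resolve_left hs, div_self hs, Real.log_one, mul_zero]
    rw [this, add_zero]

/-! ## Sectors and profiles -/

section Profiles

variable {L : Type*}

/-- The profile read off from a sector along an enumeration of the nonempty set `s` of links. -/
noncomputable def profileOn (s : Finset L) (hs : s.Nonempty) (α : L → ℕ) : SpinProfile :=
  ⟨⟨s.card, hs.card_pos⟩, fun i => (α (s.equivFin.symm i)).toPNat'⟩

variable [Fintype L]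

theorem mem_punctures {α : L → ℕ} {l : L} : l ∈ punctures α ↔ α l ≠ 0 := by simp [punctures]

/-- The default value of `toPNat'` at zero is never met, since links in the puncture set have
nonzero spin. -/
theorem prod_profileOn {M : Type*} [CommMonoid M] {s : Finset L} (hs : s.Nonempty) {α : L → ℕ}
    (hα : punctures α = s) (f : ℕ → M) :
    ∏ i, f ((profileOn s hs α).2 i) = ∏ l ∈ s, f (α l) := by
  rw [← Finset.prod_coe_sort s, ← s.equivFin.symm.prod_comp]
  refine Finset.prod_congr rfl fun i _ => ?_
  have h : α (s.equivFin.symm i) ≠ 0 := mem_punctures.1 (hα ▸ (s.equivFin.symm i).2)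
  simp [profileOn, Nat.toPNat'_coe, Nat.pos_of_ne_zero h]

theorem sum_profileOn {s : Finset L} (hs : s.Nonempty) {α : L → ℕ}
    (hα : punctures α = s) (f : ℕ → ℝ) :
    ∑ i, f ((profileOn s hs α).2 i) = ∑ l ∈ s, f (α l) :=
  prod_profileOn (M := Multiplicative ℝ) hs hα fun k => Multiplicative.ofAdd (f k)

theorem profileArea_profileOn (γ ℓ : ℝ) {s : Finset L} (hs : s.Nonempty) {α : L → ℕ}
    (hα : punctures α = s) : profileArea γ ℓ (profileOn s hs α) = sectorArea γ ℓ α := by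
  rw [profileArea, sectorArea, sum_profileOn hs hα spinArea, hα]

theorem profileOn_injective {s : Finset L} (hs : s.Nonempty) {α α' : L → ℕ}
    (hα : punctures α = s) (hα' : punctures α' = s) (h : profileOn s hs α = profileOn s hs α') :
    α = α' := by
  have h2 := eq_of_heq (Sigma.mk.inj_iff.1 h).2
  funext l
  by_cases hl : l ∈ s
  · have h3 := congrArg PNat.val (congrFun h2 (s.equivFin ⟨l, hl⟩))
    have h4 : α l ≠ 0 := mem_punctures.1 (hα ▸ hl)
    have h5 : α' l ≠ 0 := mem_punctures.1 (hα' ▸ hl)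
    simpa [Nat.toPNat'_coe, Nat.pos_of_ne_zero h4, Nat.pos_of_ne_zero h5] using h3
  · have h4 : α l = 0 := not_not.1 fun h => hl (hα ▸ mem_punctures.2 h)
    have h5 : α' l = 0 := not_not.1 fun h => hl (hα' ▸ mem_punctures.2 h)
    rw [h4, h5]

theorem exists_profileOn_eq [DecidableEq L] {s : Finset L} (J : SpinProfile) (hJ : s.card = J.1) :
    ∃ (hs : s.Nonempty) (α : L → ℕ), punctures α = s ∧ profileOn s hs α = J := by
  obtain ⟨⟨N, hN⟩, f⟩ := J
  obtain rfl : s.card = N := hJ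
  have hs : s.Nonempty := Finset.card_pos.1 hN
  refine ⟨hs, fun l => if h : l ∈ s then f (s.equivFin ⟨l, h⟩) else 0, ?_, ?_⟩
  · ext l
    rw [mem_punctures]
    by_cases h : l ∈ s <;> simp [h]
  · unfold profileOn
    congr 1
    funext i
    simp only [Subtype.coe_eta, Finset.coe_mem, dite_true]
    simp
    exact congrArg f (Equiv.apply_symm_apply _ i)

theorem punctures_nonempty {γ ℓ Ar Δ : ℝ} (hAr : Δ < Ar) {α : L → ℕ} (h : InShell γ ℓ Ar Δ α) :
    (punctures α).Nonempty := by
  by_contra hne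
  rw [Finset.not_nonempty_iff_eq_empty] at hne
  have h1 : Ar - Δ ≤ sectorArea γ ℓ α := h.1
  simp only [sectorArea, hne, Finset.sum_empty, mul_zero] at h1
  linarith

/-- The degeneracy of a sector. -/
noncomputable def sectorWeight (G : ℕ → ℝ) (α : L → ℕ) : ℝ := ∏ l ∈ punctures α, G (α l)

theorem sectorWeight_one (α : L → ℕ) : sectorWeight (fun _ => 1) α = 1 := by
  simp [sectorWeight]

/-- Sectors in the shell, of which those with equally many punctures have the same punctures,
correspond to different profiles in the window. -/
theorem sum_sectorWeight_le {γ ℓ Ar Δ : ℝ} (hγ : 0 < γ) (hℓ : 0 < ℓ) (hAr : Δ < Ar) {G : ℕ → ℝ}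
    (hG : ∀ k, 1 ≤ k → 0 ≤ G k) {A : Finset (L → ℕ)} (hA : ∀ α ∈ A, InShell γ ℓ Ar Δ α)
    (hcard : ∀ α ∈ A, ∀ α' ∈ A, (punctures α).card = (punctures α').card →
      punctures α = punctures α') :
    ∑ α ∈ A, sectorWeight G α ≤ weightedCount G γ ℓ Δ Ar := by
  classical
  rw [weightedCount_eq_sum hγ hℓ]
  have hne : ∀ α ∈ A, (punctures α).Nonempty := fun α hα => punctures_nonempty hAr (hA α hα)
  set F : {α // α ∈ A} → SpinProfile := fun α => profileOn _ (hne α.1 α.2) α.1 with hF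
  -- Equal profiles have equally many punctures, so `hcard` gives equal puncture sets and hence the
  -- same enumeration.
  have hinj : Function.Injective F := by
    rintro ⟨α, hα⟩ ⟨α', hα'⟩ h
    have h1 : (punctures α).card = (punctures α').card :=
      congrArg PNat.val (Sigma.mk.inj_iff.1 h).1
    have h2 := hcard α hα α' hα' h1
    have h3 : F ⟨α', hα'⟩ = profileOn (punctures α) (hne α hα) α' := by
      simp only [hF, h2]
    exact Subtype.ext (profileOn_injective (hne α hα) rfl h2.symm (h.trans h3))
  calc ∑ α ∈ A, sectorWeight G α = ∑ α ∈ A.attach, ∏ i, G ((F α).2 i) := by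
        rw [← Finset.sum_attach]
        exact Finset.sum_congr rfl fun α _ => (prod_profileOn (hne α.1 α.2) rfl G).symm
    _ = ∑ J ∈ A.attach.image F, ∏ i, G (J.2 i) := by
        rw [Finset.sum_image hinj.injOn]
    _ ≤ _ := by
        refine Finset.sum_le_sum_of_subset_of_nonneg ?_
          fun J _ _ => Finset.prod_nonneg fun i _ => hG _ (J.2 i).pos
        intro J hJ
        obtain ⟨α, -, rfl⟩ := Finset.mem_image.1 hJ
        rw [Set.Finite.mem_toFinset]
        have := hA α.1 α.2
        rwa [InShell, ← profileArea_profileOn γ ℓ (hne α.1 α.2) rfl] at this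

/-- With one puncture set `P N` for each number `N`, reading off spins is a bijection onto the
window. -/
theorem sum_sectorWeight_eq {γ ℓ Ar Δ : ℝ} (hγ : 0 < γ) (hℓ : 0 < ℓ) (hAr : Δ < Ar) (G : ℕ → ℝ)
    {A : Finset (L → ℕ)} (P : ℕ → Finset L)
    (hP : ∀ J ∈ window γ ℓ Ar Δ, (P J.1).card = J.1)
    (hA : ∀ α, α ∈ A ↔ InShell γ ℓ Ar Δ α ∧ ∃ J ∈ window γ ℓ Ar Δ, punctures α = P J.1) :
    ∑ α ∈ A, sectorWeight G α = weightedCount G γ ℓ Δ Ar := by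
  classical
  rw [weightedCount_eq_sum hγ hℓ]
  have hne : ∀ α ∈ A, (punctures α).Nonempty := fun α hα =>
    punctures_nonempty hAr ((hA α).1 hα).1
  refine Finset.sum_bij (fun α hα => profileOn _ (hne α hα) α) ?_ ?_ ?_ ?_
  · intro α hα
    rw [Set.Finite.mem_toFinset]
    have := ((hA α).1 hα).1
    rwa [InShell, ← profileArea_profileOn γ ℓ (hne α hα) rfl] at this
  · intro α hα α' hα' h
    have h1 : (punctures α).card = (punctures α').card :=
      congrArg PNat.val (Sigma.mk.inj_iff.1 h).1
    obtain ⟨-, J, hJ, hJα⟩ := (hA α).1 hα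
    obtain ⟨-, J', hJ', hJα'⟩ := (hA α').1 hα'
    have h2 : punctures α = punctures α' := by
      rw [hJα, hJα', hP J hJ, hP J' hJ'] at h1
      rw [hJα, hJα', h1]
    have h3 : profileOn (punctures α') (hne α' hα') α' =
        profileOn (punctures α) (hne α hα) α' := by
      simp only [h2]
    exact profileOn_injective (hne α hα) rfl h2.symm (h.trans h3)
  · intro J hJ
    rw [Set.Finite.mem_toFinset] at hJ
    obtain ⟨hs, α, hα, hαJ⟩ := exists_profileOn_eq J (hP J hJ)
    have hαA : α ∈ A := by
      refine (hA α).2 ⟨?_, J, hJ, hα⟩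
      rw [InShell, ← profileArea_profileOn γ ℓ hs hα, hαJ]
      exact hJ
    refine ⟨α, hαA, ?_⟩
    rw [← hαJ]
    simp only [hα]
  · intro α hα
    exact (prod_profileOn (hne α hα) rfl G).symm

end Profiles

/-! ## Fixed-area states of maximal entropy -/

section BasisTensor

variable {m k : Type*} [DecidableEq m] [DecidableEq k]

open Classical in
/-- A pure tensor of basis vectors. -/
noncomputable def basisTensor : Matrix m k ℂ :=
  if h : Nonempty m ∧ Nonempty k then
    Matrix.vecMulVec (Pi.single h.1.some 1) (Pi.single h.2.some 1) else 0

theorem exists_basisTensor_eq_vecMulVec :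
    ∃ (u : m → ℂ) (v : k → ℂ), basisTensor = Matrix.vecMulVec u v := by
  by_cases h : Nonempty m ∧ Nonempty k
  · exact ⟨_, _, dif_pos h⟩
  · exact ⟨0, 0, (dif_neg h).trans (by simp)⟩

theorem trace_basisTensor [Fintype m] [Fintype k] [hm : Nonempty m] [hk : Nonempty k] :
    ((basisTensor : Matrix m k ℂ) * (basisTensor : Matrix m k ℂ).conjTranspose).trace = 1 := by
  rw [basisTensor, dif_pos ⟨hm, hk⟩]
  simp [Matrix.trace, Matrix.mul_apply, Matrix.vecMulVec_apply, Pi.single_apply]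

end BasisTensor

theorem noBulkEntanglement_of_basisTensor {L : Type*} {Λ : Finset (L → ℕ)}
    {a b : (L → ℕ) → Type*} [∀ α, DecidableEq (a α)] [∀ α, DecidableEq (b α)] {Ψ : StateSpace Λ a b}
    (h : HasBulkStates (fun _ => basisTensor) Ψ) : NoBulkEntanglement Ψ := by
  obtain ⟨p, -, hp⟩ := h
  intro α
  obtain ⟨u, v, huv⟩ := exists_basisTensor_eq_vecMulVec (m := a α) (k := b α)
  refine ⟨√(p α) • u, v, (hp α).trans ?_⟩
  beta_reduce
  rw [huv, Matrix.smul_vecMulVec]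

section MaximalEntropy

variable {L : Type*} {Λ : Finset (L → ℕ)} {a b : (L → ℕ) → Type*}
  [∀ α, Fintype (a α)] [∀ α, Fintype (b α)]

/-- The sectors supported on the sets `P N` have weights summing to `𝒟_G`, so the weights divided by
`𝒟_G` are probabilities. -/
theorem exists_fixedArea_state [Fintype L] [DecidableEq L] {γ ℓ Ar Δ : ℝ} (hγ : 0 < γ) (hℓ : 0 < ℓ) (hAr : Δ < Ar)
    {G : ℕ → ℝ} {P : ℕ → Finset L} (hP : Admits Λ a b γ ℓ Ar Δ P)
    (hne : (window γ ℓ Ar Δ).Nonempty) (ψ : ∀ α, Matrix (a α) (b α) ℂ)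
    (hψ : ∀ α ∈ Λ, InShell γ ℓ Ar Δ α → Nonempty (a α) → Nonempty (b α) →
      (ψ α * (ψ α).conjTranspose).trace = 1 ∧ 0 < sectorWeight G α) :
    ∃ Ψ : StateSpace Λ a b, IsFixedArea γ ℓ Ar Δ Ψ ∧ HasBulkStates ψ Ψ ∧
      ∀ α, prob Ψ α = 0 ∨ prob Ψ α = sectorWeight G α.1 / weightedCount G γ ℓ Δ Ar := by
  classical
  set good : (L → ℕ) → Prop := fun α =>
    InShell γ ℓ Ar Δ α ∧ ∃ J ∈ window γ ℓ Ar Δ, punctures α = P J.1 with hgood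
  have hgoodΛ : ∀ α, good α → α ∈ Λ ∧ (ψ α * (ψ α).conjTranspose).trace = 1 ∧
      0 < sectorWeight G α := by
    rintro α ⟨hα, J, hJ, hJα⟩
    obtain ⟨h1, h2, h3⟩ := (hP J hJ).2 α hJα hα
    exact ⟨h1, hψ α h1 hα h2 h3⟩
  set D := weightedCount G γ ℓ Δ Ar with hD
  have hsum : ∑ α ∈ Λ.filter good, sectorWeight G α = D :=
    sum_sectorWeight_eq hγ hℓ hAr G P (fun J hJ => (hP J hJ).1) fun α => by
      rw [Finset.mem_filter]
      exact ⟨fun h => h.2, fun h => ⟨(hgoodΛ α h).1, h⟩⟩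
  have hD0 : 0 < D := by
    rw [← hsum]
    refine Finset.sum_pos (fun α hα => (hgoodΛ α (Finset.mem_filter.1 hα).2).2.2) ?_
    obtain ⟨J, hJ⟩ := hne
    obtain ⟨hs, α, hα, hαJ⟩ := exists_profileOn_eq J (hP J hJ).1
    have hg : good α := by
      refine ⟨?_, J, hJ, hα⟩
      rw [InShell, ← profileArea_profileOn γ ℓ hs hα, hαJ]
      exact hJ
    exact ⟨α, Finset.mem_filter.2 ⟨(hgoodΛ α hg).1, hg⟩⟩
  set p : Λ → ℝ := fun α => if good α.1 then sectorWeight G α.1 / D else 0 with hp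
  have hp0 : ∀ α, 0 ≤ p α := by
    intro α
    simp only [hp]
    split_ifs with h
    · exact div_nonneg (hgoodΛ α.1 h).2.2.le hD0.le
    · exact le_rfl
  set Ψ : StateSpace Λ a b :=
    WithLp.toLp 2 fun x => (√(p x.1) : ℝ) • ψ x.1.1 x.2.1 x.2.2 with hΨ
  have hcomp : ∀ α : Λ, component Ψ α = (√(p α) : ℝ) • ψ α.1 := by
    intro α
    ext i k
    simp [component, hΨ, Matrix.smul_apply]
  have hcompne : ∀ α : Λ, component Ψ α ≠ 0 → good α.1 := by
    intro α h
    by_contra hg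
    exact h (by rw [hcomp α]; simp [hp, hg])
  have hprob : ∀ α : Λ, prob Ψ α = p α := by
    intro α
    -- Outside `good` the bulk state need not be normalised, but the component vanishes.
    by_cases hg : good α.1
    · exact sectorProb_of_component (hp0 α) (hgoodΛ α.1 hg).2.1 (hcomp α)
    · have : p α = 0 := by simp [hp, hg]
      rw [this]
      exact (sectorProb_eq_zero_iff Ψ α).2 (by rw [hcomp α, this]; simp)
  refine ⟨Ψ, ⟨?_, ?_, fun α h => (hcompne α h).1⟩, ⟨p, hp0, hcomp⟩, fun α => ?_⟩
  · have h1 : ‖Ψ‖ ^ 2 = 1 := by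
      rw [← sum_sectorProb]
      calc ∑ α, sectorProb (pureDensity Ψ) α = ∑ α : Λ, p α :=
            Finset.sum_congr rfl fun α _ => hprob α
        _ = ∑ α ∈ Λ, if good α then sectorWeight G α / D else 0 :=
            Finset.sum_coe_sort Λ fun α => if good α then sectorWeight G α / D else 0
        _ = 1 := by rw [← Finset.sum_filter, ← Finset.sum_div, hsum, div_self hD0.ne']
    exact (pow_eq_one_iff_of_nonneg (norm_nonneg Ψ) two_ne_zero).1 h1
  · intro α α' h h' hc
    obtain ⟨-, J, hJ, hJα⟩ := hcompne α h
    obtain ⟨-, J', hJ', hJα'⟩ := hcompne α' h'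
    rw [hJα, hJα', (hP J hJ).1, (hP J' hJ').1] at hc
    rw [hJα, hJα', hc]
  · rw [hprob α]
    simp only [hp]
    split_ifs
    · exact Or.inr rfl
    · exact Or.inl rfl

variable [∀ α, DecidableEq (a α)]

theorem vonNeumann_of_noBulkEntanglement {Ψ : StateSpace Λ a b} (h : NoBulkEntanglement Ψ) {α : Λ}
    (hα : component Ψ α ≠ 0) : vonNeumann (reducedDensity (pureDensity Ψ) α) = 0 := by
  obtain ⟨u, v, huv⟩ := h α
  set p := sectorProb (pureDensity Ψ) α with hp
  have hp0 : 0 < p := lt_of_le_of_ne (sectorProb_nonneg Ψ α)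
    (Ne.symm ((sectorProb_eq_zero_iff Ψ α).not.2 hα))
  have hs : √p ≠ 0 := (Real.sqrt_pos.2 hp0).ne'
  -- Absorbing `1 / √p` into `u` gives trace one, as the rank-one lemma requires.
  set ψ : Matrix (a α.1) (b α.1) ℂ := Matrix.vecMulVec ((√p)⁻¹ • u) v with hψ
  have h1 : component Ψ α = (√p : ℝ) • ψ := by
    rw [huv]
    ext i k
    simp [hψ, Matrix.vecMulVec_apply, Matrix.smul_apply, ← mul_assoc, hs]
  have htr : (ψ * ψ.conjTranspose).trace = 1 := by
    have h2 := component_mul_conjTranspose hp0.le h1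
    have h3 : (component Ψ α * (component Ψ α).conjTranspose).trace = (p : ℂ) := by
      obtain ⟨U, d, hd⟩ := (Matrix.isHermitian_mul_conjTranspose_self
        (component Ψ α)).exists_diagonalises
      rw [hp, sectorProb, partialTrace_block_pureDensity, hd.trace, Complex.ofReal_re]
    rw [h2, Matrix.trace_smul, Complex.real_smul] at h3
    exact (mul_eq_left₀ (Complex.ofReal_ne_zero.2 hp0.ne')).1 h3
  rw [reducedDensity_of_component (a := fun α : Λ => a α) (b := fun α : Λ => b α) (s := α) hp0 htr h1]
  exact vonNeumann_vecMulVec _ _ htr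

variable [∀ α, DecidableEq (b α)]

variable [Fintype L]

/-- The common core of all three entropy bounds: `hw` says that `λ_α exp S_α` is the degeneracy of
the sector, which makes the entropy the Gibbs functional with these weights. -/
theorem entropy_le_log_weightedCount {γ ℓ Ar Δ : ℝ} (hγ : 0 < γ) (hℓ : 0 < ℓ) (hAr : Δ < Ar)
    {G : ℕ → ℝ} (hG : ∀ k, 1 ≤ k → 0 ≤ G k) {lam : Λ → ℝ} (hlam : ∀ α, 0 < lam α)
    {Ψ : StateSpace Λ a b} (hΨ : IsFixedArea γ ℓ Ar Δ Ψ)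
    (hw : ∀ α : Λ, component Ψ α ≠ 0 → 0 < sectorWeight G α.1 ∧
      vonNeumann (reducedDensity (pureDensity Ψ) α) + Real.log (lam α) =
        Real.log (sectorWeight G α.1)) :
    entropy lam (pureDensity Ψ) ≤ Real.log (weightedCount G γ ℓ Δ Ar) ∧
      (entropy lam (pureDensity Ψ) = Real.log (weightedCount G γ ℓ Δ Ar) ↔
        ∀ α, prob Ψ α = 0 ∨ prob Ψ α = sectorWeight G α.1 / weightedCount G γ ℓ Δ Ar) := by
  have hne : ∀ α : Λ, prob Ψ α ≠ 0 → component Ψ α ≠ 0 := fun α h =>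
    (sectorProb_eq_zero_iff Ψ α).not.1 h
  have hent : entropy lam (pureDensity Ψ) =
      ∑ α, prob Ψ α * (Real.log (sectorWeight G α.1) - Real.log (prob Ψ α)) := by
    rw [entropy_pureDensity lam hlam]
    refine Finset.sum_congr rfl fun α _ => ?_
    by_cases h0 : prob Ψ α = 0
    · rw [prob] at h0
      simp [prob, h0]
    · rw [← (hw α (hne α h0)).2, prob, Real.log_div (x := sectorProb _ _) h0 (hlam α).ne']
      ring
  rw [hent]
  refine gibbs_inequality (fun α => sectorProb_nonneg Ψ α) ?_ (fun α h => (hw α (hne α h)).1) ?_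
  · have := sum_sectorProb Ψ
    rw [hΨ.norm_eq, one_pow] at this
    exact this
  · refine (Finset.sum_map (Finset.univ.filter fun α : Λ => prob Ψ α ≠ 0)
      (Function.Embedding.subtype _) (fun α : L → ℕ => sectorWeight G α)).symm.trans_le ?_
    refine sum_sectorWeight_le hγ hℓ hAr hG ?_ ?_
    · intro α hα
      obtain ⟨α, h, rfl⟩ := Finset.mem_map.1 hα
      exact hΨ.in_shell α (hne α (Finset.mem_filter.1 h).2)
    · intro α hα α' hα'
      obtain ⟨α, h, rfl⟩ := Finset.mem_map.1 hα
      obtain ⟨α', h', rfl⟩ := Finset.mem_map.1 hα'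
      exact hΨ.puncture_sets α α' (hne α (Finset.mem_filter.1 h).2)
        (hne α' (Finset.mem_filter.1 h').2)

variable [DecidableEq L]

/-- States without bulk entanglement, the weights `λ` being a degeneracy per puncture. -/
theorem noBulkEntanglement_maximal {γ ℓ Ar Δ : ℝ} (hγ : 0 < γ) (hℓ : 0 < ℓ) (hAr : Δ < Ar)
    {G : ℕ → ℝ} (hG : ∀ k, 1 ≤ k → 0 < G k) :
    (∀ Ψ : StateSpace Λ a b, IsFixedArea γ ℓ Ar Δ Ψ → NoBulkEntanglement Ψ →
      entropy (fun α : Λ => sectorWeight G α.1) (pureDensity Ψ) ≤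
          Real.log (weightedCount G γ ℓ Δ Ar) ∧
        (entropy (fun α : Λ => sectorWeight G α.1) (pureDensity Ψ) =
            Real.log (weightedCount G γ ℓ Δ Ar) ↔
          ∀ α, prob Ψ α = 0 ∨ prob Ψ α = sectorWeight G α.1 / weightedCount G γ ℓ Δ Ar)) ∧
      ((window γ ℓ Ar Δ).Nonempty → (∃ P : ℕ → Finset L, Admits Λ a b γ ℓ Ar Δ P) →
        ∃ Ψ : StateSpace Λ a b, IsFixedArea γ ℓ Ar Δ Ψ ∧ NoBulkEntanglement Ψ ∧
          entropy (fun α : Λ => sectorWeight G α.1) (pureDensity Ψ) =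
            Real.log (weightedCount G γ ℓ Δ Ar)) := by
  have hpos : ∀ α : L → ℕ, 0 < sectorWeight G α := fun α => Finset.prod_pos fun l hl =>
    hG _ (Nat.pos_of_ne_zero (mem_punctures.1 hl))
  have main : ∀ Ψ : StateSpace Λ a b, IsFixedArea γ ℓ Ar Δ Ψ → NoBulkEntanglement Ψ → _ :=
    fun Ψ hΨ hN => entropy_le_log_weightedCount hγ hℓ hAr (fun k hk => (hG k hk).le)
      (lam := fun α : Λ => sectorWeight G α.1) (fun α => hpos α.1) hΨ fun α hα =>
        ⟨hpos α.1, by rw [vonNeumann_of_noBulkEntanglement hN hα, zero_add]⟩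
  refine ⟨main, fun hne ⟨P, hP⟩ => ?_⟩
  obtain ⟨Ψ, h1, h2, h3⟩ := exists_fixedArea_state hγ hℓ hAr (G := G) hP hne
    (fun _ => basisTensor) fun α _ _ _ _ => ⟨trace_basisTensor, hpos α⟩
  have h4 := noBulkEntanglement_of_basisTensor h2
  exact ⟨Ψ, h1, h4, (main Ψ h1 h4).2.2 h3⟩

/-- States with the bulk entanglement prescribed by a degeneracy per puncture. -/
theorem bulkStates_maximal {γ ℓ Ar Δ : ℝ} (hγ : 0 < γ) (hℓ : 0 < ℓ) (hAr : Δ < Ar)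
    {G : ℕ → ℝ} (hG : ∀ k, 1 ≤ k → 0 ≤ G k) (ψ : ∀ α, Matrix (a α) (b α) ℂ)
    (hψ : ∀ α ∈ Λ, InShell γ ℓ Ar Δ α → (ψ α * (ψ α).conjTranspose).trace = 1 ∧
      Real.exp (vonNeumann (ψ α * (ψ α).conjTranspose)) = sectorWeight G α) :
    (∀ Ψ : StateSpace Λ a b, IsFixedArea γ ℓ Ar Δ Ψ → HasBulkStates ψ Ψ →
      stateEntropy Ψ ≤ Real.log (weightedCount G γ ℓ Δ Ar) ∧
      (stateEntropy Ψ = Real.log (weightedCount G γ ℓ Δ Ar) ↔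
        ∀ α : Λ, prob Ψ α = 0 ∨ prob Ψ α =
          Real.exp (vonNeumann (ψ α * (ψ α).conjTranspose)) / weightedCount G γ ℓ Δ Ar)) ∧
    ((window γ ℓ Ar Δ).Nonempty → (∃ P : ℕ → Finset L, Admits Λ a b γ ℓ Ar Δ P) →
      ∃ Ψ : StateSpace Λ a b, IsFixedArea γ ℓ Ar Δ Ψ ∧ HasBulkStates ψ Ψ ∧
        stateEntropy Ψ = Real.log (weightedCount G γ ℓ Δ Ar)) := by
  have hpos : ∀ α ∈ Λ, InShell γ ℓ Ar Δ α → 0 < sectorWeight G α := fun α hα hs => by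
    rw [← (hψ α hα hs).2]; exact Real.exp_pos _
  have main : ∀ Ψ : StateSpace Λ a b, IsFixedArea γ ℓ Ar Δ Ψ → HasBulkStates ψ Ψ → _ :=
    fun Ψ hΨ hN => entropy_le_log_weightedCount hγ hℓ hAr hG
      (lam := fun _ : Λ => 1) (fun _ => one_pos) hΨ fun α hα => by
        have hs := hΨ.in_shell α hα
        obtain ⟨p, hp0, hp⟩ := hN
        have hpα : 0 < p α := lt_of_le_of_ne (hp0 α) fun h0 => hα (by rw [hp α, ← h0]; simp)
        refine ⟨hpos α.1 α.2 hs, ?_⟩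
        rw [reducedDensity_of_component (a := fun α : Λ => a α) (b := fun α : Λ => b α) (s := α) hpα (hψ α.1 α.2 hs).1 (hp α), ← (hψ α.1 α.2 hs).2,
          Real.log_exp, Real.log_one, add_zero]
  refine ⟨fun Ψ hΨ hN => ⟨(main Ψ hΨ hN).1, (main Ψ hΨ hN).2.trans (forall_congr' fun α => ?_)⟩,
    fun hne ⟨P, hP⟩ => ?_⟩
  · by_cases hα : component Ψ α = 0
    · have : prob Ψ α = 0 := (sectorProb_eq_zero_iff Ψ α).2 hα
      simp [this]
    · rw [(hψ α.1 α.2 (hΨ.in_shell α hα)).2]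
  · obtain ⟨Ψ, h1, h2, h3⟩ := exists_fixedArea_state hγ hℓ hAr (G := G) hP hne ψ
      fun α hα hs _ _ => ⟨(hψ α hα hs).1, hpos α hα hs⟩
    exact ⟨Ψ, h1, h2, (main Ψ h1 h2).2.2 h3⟩

end MaximalEntropy

/-- The reduced density of a product state is the product of those at the punctures, so traces
multiply and entropies add. -/
theorem productState_factorised {L : Type*} [Fintype L] [DecidableEq L] {κ κ' : ℕ → Type*}
    [∀ k, Fintype (κ k)] [∀ k, DecidableEq (κ k)] [∀ k, Fintype (κ' k)]
    (F : ∀ k, Matrix (κ k) (κ' k) ℂ)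
    (hF : ∀ k, 1 ≤ k → (F k * (F k).conjTranspose).trace = 1) (α : L → ℕ) :
    (productState F α * (productState F α).conjTranspose).trace = 1 ∧
      Real.exp (vonNeumann (productState F α * (productState F α).conjTranspose)) =
        ∏ l ∈ punctures α, Real.exp (vonNeumann (F (α l) * (F (α l)).conjTranspose)) := by
  have e : productState F α * (productState F α).conjTranspose =
      piProduct fun l : punctures α => F (α l) * (F (α l)).conjTranspose := by
    rw [show productState F α = piProduct fun l : punctures α => F (α l) from rfl,
      piProduct_conjTranspose, piProduct_mul]
  have htr : ∀ l : punctures α, (F (α l) * (F (α l)).conjTranspose).trace = 1 := fun l =>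
    hF _ (Nat.pos_of_ne_zero (mem_punctures.1 l.2))
  rw [e]
  refine ⟨by rw [trace_piProduct]; exact Finset.prod_eq_one fun l _ => htr l, ?_⟩
  rw [vonNeumann_piProduct (fun l => Matrix.isHermitian_mul_conjTranspose_self _) htr, Real.exp_sum]
  exact Finset.prod_coe_sort (punctures α)
    fun l => Real.exp (vonNeumann (F (α l) * (F (α l)).conjTranspose))

end LQG

/-! ### The main theorem -/

open LQG in
theorem mainTheorem2 (γ ℓ Δ : ℝ) (hγ : 0 < γ) (hℓ : 0 < ℓ) (hΔ : 0 < Δ) :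
    -- the counts are finite
    (∀ Ar : ℝ, (window γ ℓ Ar Δ).Finite) ∧
    -- no bulk entanglement: the maximal entropy is `log 𝒟`, attained by uniform probabilities
    (∀ Ar : ℝ, Δ < Ar → ∀ (L : Type*) [Fintype L] [DecidableEq L] (Λ : Finset (L → ℕ))
      (a b : (L → ℕ) → Type*) [∀ α, Fintype (a α)] [∀ α, DecidableEq (a α)]
      [∀ α, Fintype (b α)] [∀ α, DecidableEq (b α)],
      (∀ Ψ : StateSpace Λ a b, IsFixedArea γ ℓ Ar Δ Ψ → NoBulkEntanglement Ψ →
        stateEntropy Ψ ≤ Real.log (microCount γ ℓ Δ Ar) ∧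
        (stateEntropy Ψ = Real.log (microCount γ ℓ Δ Ar) ↔
          ∀ α, prob Ψ α = 0 ∨ prob Ψ α = 1 / microCount γ ℓ Δ Ar)) ∧
      ((window γ ℓ Ar Δ).Nonempty → (∃ P : ℕ → Finset L, Admits Λ a b γ ℓ Ar Δ P) →
        ∃ Ψ : StateSpace Λ a b, IsFixedArea γ ℓ Ar Δ Ψ ∧ NoBulkEntanglement Ψ ∧
          stateEntropy Ψ = Real.log (microCount γ ℓ Δ Ar))) ∧
    -- area law for a general degeneracy
    (∀ G : ℕ → ℝ, (∀ k, 1 ≤ k → 0 ≤ G k) →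
      (∃ k l, 1 ≤ k ∧ 1 ≤ l ∧ 0 < G k ∧ 0 < G l ∧ Irrational (spinArea k / spinArea l)) →
      ∀ β : ℝ, SolvesBeta G β →
        Summable (fun k : ℕ+ => spinArea k * (G k * Real.exp (-β * spinArea k))) →
        (∀ β', SolvesBeta G β' → β' = β) ∧ AreaLaw γ ℓ β (weightedCount G γ ℓ Δ)) ∧
    -- area law for `𝒟`
    (∃ β₀ : ℝ, SolvesBeta (fun _ => 1) β₀ ∧ (∀ β', SolvesBeta (fun _ => 1) β' → β' = β₀) ∧
      |β₀ - 1.01527| < 0.000005 ∧ AreaLaw γ ℓ β₀ (microCount γ ℓ Δ)) ∧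
    -- puncture-factorised bulk entanglement
    (∀ Ar : ℝ, Δ < Ar → ∀ (L : Type*) [Fintype L] [DecidableEq L] (Λ : Finset (L → ℕ))
      (a b : (L → ℕ) → Type*) [∀ α, Fintype (a α)] [∀ α, DecidableEq (a α)]
      [∀ α, Fintype (b α)] [∀ α, DecidableEq (b α)]
      (ψ : ∀ α, Matrix (a α) (b α) ℂ) (G : ℕ → ℝ),
      (∀ k, 1 ≤ k → 0 ≤ G k) →
      (∀ α ∈ Λ, InShell γ ℓ Ar Δ α → (ψ α * (ψ α).conjTranspose).trace = 1 ∧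
        Real.exp (vonNeumann (ψ α * (ψ α).conjTranspose)) = ∏ l ∈ punctures α, G (α l)) →
      (∀ Ψ : StateSpace Λ a b, IsFixedArea γ ℓ Ar Δ Ψ → HasBulkStates ψ Ψ →
        stateEntropy Ψ ≤ Real.log (weightedCount G γ ℓ Δ Ar) ∧
        (stateEntropy Ψ = Real.log (weightedCount G γ ℓ Δ Ar) ↔
          ∀ α : Λ, prob Ψ α = 0 ∨ prob Ψ α =
            Real.exp (vonNeumann (ψ α * (ψ α).conjTranspose)) / weightedCount G γ ℓ Δ Ar)) ∧
      ((window γ ℓ Ar Δ).Nonempty → (∃ P : ℕ → Finset L, Admits Λ a b γ ℓ Ar Δ P) →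
        ∃ Ψ : StateSpace Λ a b, IsFixedArea γ ℓ Ar Δ Ψ ∧ HasBulkStates ψ Ψ ∧
          stateEntropy Ψ = Real.log (weightedCount G γ ℓ Δ Ar))) ∧
    -- product states over the punctures are puncture-factorised
    (∀ (L : Type*) [Fintype L] [DecidableEq L] (κ κ' : ℕ → Type*)
      [∀ k, Fintype (κ k)] [∀ k, DecidableEq (κ k)] [∀ k, Fintype (κ' k)]
      (F : ∀ k, Matrix (κ k) (κ' k) ℂ),
      (∀ k, 1 ≤ k → (F k * (F k).conjTranspose).trace = 1) →
      ∀ α : L → ℕ,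
        (productState F α * (productState F α).conjTranspose).trace = 1 ∧
        Real.exp (vonNeumann (productState F α * (productState F α).conjTranspose)) =
          ∏ l ∈ punctures α, Real.exp (vonNeumann (F (α l) * (F (α l)).conjTranspose))) ∧
    -- edge modes: the entropy with `λ_α = ∏ (2 j + 1)`
    (∀ Ar : ℝ, Δ < Ar → ∀ (L : Type*) [Fintype L] [DecidableEq L] (Λ : Finset (L → ℕ))
      (a b : (L → ℕ) → Type*) [∀ α, Fintype (a α)] [∀ α, DecidableEq (a α)]
      [∀ α, Fintype (b α)] [∀ α, DecidableEq (b α)],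
      (∀ Ψ : StateSpace Λ a b, IsFixedArea γ ℓ Ar Δ Ψ → NoBulkEntanglement Ψ →
        edgeEntropy Ψ ≤ Real.log (weightedCount (fun k => 2 * spin k + 1) γ ℓ Δ Ar) ∧
        (edgeEntropy Ψ = Real.log (weightedCount (fun k => 2 * spin k + 1) γ ℓ Δ Ar) ↔
          ∀ α, prob Ψ α = 0 ∨ prob Ψ α =
            edgeWeight α.1 / weightedCount (fun k => 2 * spin k + 1) γ ℓ Δ Ar)) ∧
      ((window γ ℓ Ar Δ).Nonempty → (∃ P : ℕ → Finset L, Admits Λ a b γ ℓ Ar Δ P) →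
        ∃ Ψ : StateSpace Λ a b, IsFixedArea γ ℓ Ar Δ Ψ ∧ NoBulkEntanglement Ψ ∧
          edgeEntropy Ψ = Real.log (weightedCount (fun k => 2 * spin k + 1) γ ℓ Δ Ar))) ∧
    (∃ β : ℝ, SolvesBeta (fun k => 2 * spin k + 1) β ∧
      (∀ β', SolvesBeta (fun k => 2 * spin k + 1) β' → β' = β) ∧
      |β / (2 * Real.pi) - 0.274067| < 0.0000005 ∧
      AreaLaw γ ℓ β (weightedCount (fun k => 2 * spin k + 1) γ ℓ Δ)) := by
  refine ⟨fun Ar => window_finite hγ hℓ Ar Δ, ?_, ?_, ?_, ?_, ?_, ?_, ?_⟩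
  · intro Ar hAr L _ _ Λ a b _ _ _ _
    have h := noBulkEntanglement_maximal (Λ := Λ) (a := a) (b := b) hγ hℓ hAr (G := fun _ => 1)
      fun _ _ => one_pos
    simp only [sectorWeight_one, ← microCount_eq_weightedCount hγ hℓ] at h
    exact h
  · intro G hG hirr β hβ hmean
    exact ⟨fun β' hβ' => hβ.unique hG hβ', hβ.areaLaw hγ hℓ hΔ hG hirr hmean⟩
  · obtain ⟨β, h1, h2, h3⟩ := exists_solvesBeta_one
    refine ⟨β, h1, fun β' hβ' => h1.unique (fun _ _ => zero_le_one) hβ', h3, ?_⟩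
    rw [funext (microCount_eq_weightedCount hγ hℓ Δ)]
    exact areaLaw_of_le_succ hγ hℓ hΔ (fun _ _ => one_pos)
      (fun k => by linarith [Nat.cast_nonneg (α := ℝ) k]) h2 h1
  · intro Ar hAr L _ _ Λ a b _ _ _ _ ψ G hG hψ
    exact bulkStates_maximal hγ hℓ hAr hG ψ hψ
  · intro L _ _ κ κ' _ _ _ F hF α
    exact productState_factorised F hF α
  · intro Ar hAr L _ _ Λ a b _ _ _ _
    -- `edgeWeight` is by definition the `sectorWeight` of the degeneracy `2 j + 1`.
    exact noBulkEntanglement_maximal hγ hℓ hAr (G := fun k => 2 * spin k + 1)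
      fun k _ => by unfold spin; positivity
  · obtain ⟨β, h1, h2, h3⟩ := exists_solvesBeta_edge
    have hpos : ∀ k : ℕ, 0 < 2 * spin k + 1 := fun k => by unfold spin; positivity
    exact ⟨β, h1, fun β' hβ' => h1.unique (fun k _ => (hpos k).le) hβ', h3,
      areaLaw_of_le_succ hγ hℓ hΔ (fun k _ => hpos k) (fun k => by rw [spin]; linarith) h2 h1⟩
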